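/- **Setting.** Let $-\infty\le a<b\le\infty$, $I=(a,b)$, let $f:I\to(0,\infty)$ be smooth, and let $(S,h)$ be a connected smooth Riemannian manifold with Riemannian distance $d_S$ (the infimum of the lengths of piecewise smooth curves). Consider the generalized Robertson–Walker (GRW) spacetime $(M,g)=(I\times S,\,-dt^2+f^2(t)\,h)$, time-oriented by $\partial_t$, and write its points as $p=(t_p,p_S)$. Let $\phi:I\to\mathbb R$ be smooth with $\phi'(t)>0$ for all $t\in I$, and let $\tau(t,x)=\phi(t)$. **Distances.** - The *Riemannianized distance* $d^R_\tau$ is the Riemannian distance of $g^R_\tau=\frac{2}{\|\nabla\tau\|_g^2}\,d\tau^2+g$, where $\|V\|_g=\sqrt{|g(V,V)|}$. - The *elevator distance* $d^E_\tau(p,q)$ is the infimum of the $g^R_\tau$-lengths of the curves from $p$ to $q$ that consist of finitely many smooth pieces, each of constant $S$-component or of constant $I$-component. - The *null distance* $\hat d_\tau(p,q)$ is the infimum of $\sum_{i=1}^m|\tau(x_i)-\tau(x_{i-1})|$ over the piecewise causal curves from $p$ to $q$ with break points $x_0=p,x_1,\dots,x_m=q$, that is, curves consisting of finitely many smooth pieces,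 each of which is future-directed causal, past-directed causal, or constant. We write $d^R_t,d^E_t,\hat d_t$ for the distances induced by $\tau(t,x)=t$. **Faithfulness properties.** For $J\subset I$ put $A_J=\inf_J f$, and $f_{\inf}=A_I$. For $a\le t_1<t_2\le b$ and $t_p,t_q\in(t_1,t_2)$ let $$E_{(t_1,t_2)}(t_p,t_q)=\begin{cases}\min\{t_p+t_q-2t_1,\;2t_2-t_p-t_q\}& a<t_1<t_2<b,\\ t_p+t_q-2t_1& a<t_1<t_2=b,\\ 2t_2-t_p-t_q& a=t_1<t_2<b,\\ \infty& a=t_1<t_2=b.\end{cases}$$ A distance function $d$ on $M$ satisfies (F$i$) with constant $C_i>0$ if, for all $p,q\in M$: - (F1) $p_S=q_S\Rightarrow C_1|t_q-t_p|\le d(p,q)$; - (F2) $p_S=q_S\Rightarrow d(p,q)\le C_2|t_q-t_p|$; - (F3) $t_p=t_q\Rightarrow d(p,q)\le C_3\,f(t_p)\,d_S(p_S,q_S)$; - (F4) $d(p,q)\le C_4\big(|t_p-c|+f(c)\,d_S(p_S,q_S)+|t_q-c|\big)$ for all $c\in I$; - (F5) $C_5\,f_{\inf}\,d_S(p_S,q_S)\le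 d(p,q)$; - (F6) $C_6\min\{E_{(t_1,t_2)}(t_p,t_q),\,A_{(t_1,t_2)}\,d_S(p_S,q_S)\}\le d(p,q)$ for every subinterval $(t_1,t_2)\subset(a,b)$ with $t_p,t_q\in(t_1,t_2)$. **Theorem.** - (a) $d^R_\tau=d^R_t$, and it satisfies (F1)–(F6) with $C_1=\dots=C_6=1$. - (b) $d^E_\tau=d^E_t$, and it satisfies (F1)–(F6) with $C_1=\dots=C_6=1$. - (c) (i) If $C,D>0$ are constants with $C\le\phi'(t)\le D$ for all $t\in I$, then $\hat d_\tau$ satisfies (F1)–(F6) with $C_1=C_5=C_6=C$ and $C_2=C_3=C_4=D$. (ii) Conversely, if $\hat d_\tau$ satisfies (F1) and (F2) with constants $C_1$ and $C_2$, then $C_1\le\phi'(t)\le C_2$ for all $t\in I$. In particular, $\hat d_\tau$ satisfies all of (F1)–(F6) (for some constants) if and only if it satisfies (F1) and (F2), and $\hat d_t$ satisfies (F1)–(F6) with $C_1=\dots=C_6=1$. -/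

import Mathlib

open Set MeasureTheory Bundle
open scoped Manifold ContDiff ENNReal

noncomputable section

/-! ### Curves, lengths and distances on an open subset `U` of a smooth manifold `X`

The manifold under consideration is the open subset `U` of `X` (all of `X` for `U = univ`), and
curves are required to stay in `U`. -/

section General

variable {E H X : Type*} [NormedAddCommGroup E] [NormedSpace ℝ E] [TopologicalSpace H]
  [TopologicalSpace X] [ChartedSpace H X]

/-- A field of `(0,2)`-forms on the tangent spaces of `X` (used below for metric tensors). -/
abbrev TensorField2 (I : ModelWithCorners ℝ E H) (X : Type*) [TopologicalSpace X]
    [ChartedSpace H X] : Type _ :=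
  ∀ p : X, TangentSpace I p → TangentSpace I p → ℝ

/-- The velocity at time `t` of a curve considered on the closed interval `[u, v]`
(one-sided at the two endpoints). -/
def velocity (I : ModelWithCorners ℝ E H) (γ : ℝ → X) (u v t : ℝ) : TangentSpace I (γ t) :=
  mfderivWithin 𝓘(ℝ, ℝ) I γ (Icc u v) t (1 : ℝ)

/-- `γ`, on `[s 0, s m]` with breaks `s 0 < s 1 < ⋯ < s m`, is a piecewise smooth curve in `U`:
it is smooth on each closed interval `[s i, s (i + 1)]` (hence continuous on `[s 0, s m]`). -/
def IsPiecewiseSmooth (I : ModelWithCorners ℝ E H) (U : Set X) (γ : ℝ → X) (m : ℕ) (s : ℕ → ℝ) :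
    Prop :=
  0 < m ∧ ∀ i < m, s i < s (i + 1) ∧
    ContMDiffOn 𝓘(ℝ, ℝ) I ∞ γ (Icc (s i) (s (i + 1))) ∧ MapsTo γ (Icc (s i) (s (i + 1))) U

/-- The arc length `∫ √(g(γ', γ'))` of a piecewise smooth curve. -/
def arcLength (I : ModelWithCorners ℝ E H) (g : TensorField2 I X) (γ : ℝ → X) (m : ℕ)
    (s : ℕ → ℝ) : ℝ≥0∞ :=
  ∑ i ∈ Finset.range m, ∫⁻ t in Icc (s i) (s (i + 1)),
    ENNReal.ofReal (√(g (γ t) (velocity I γ (s i) (s (i + 1)) t)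
      (velocity I γ (s i) (s (i + 1)) t)))

/-- The Riemannian distance of `(U, g)`: the infimum of the lengths of the piecewise smooth curves
in `U` from `p` to `q`. -/
def riemDist (I : ModelWithCorners ℝ E H) (g : TensorField2 I X) (U : Set X) (p q : X) : ℝ≥0∞ :=
  ⨅ (γ : ℝ → X) (m : ℕ) (s : ℕ → ℝ) (_ : IsPiecewiseSmooth I U γ m s)
    (_ : γ (s 0) = p) (_ : γ (s m) = q), arcLength I g γ m s

/-- The differential `dτ` of a real function at `p`. -/
def differential (I : ModelWithCorners ℝ E H) (τ : X → ℝ) (p : X) : TangentSpace I p →L[ℝ] ℝ :=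
  mfderiv I 𝓘(ℝ, ℝ) τ p

/-- The gradient `∇τ` with respect to the (nondegenerate) form `g`: the vector with
`g(∇τ, w) = dτ(w)` for all `w`. -/
def metricGradient (I : ModelWithCorners ℝ E H) (g : TensorField2 I X) (τ : X → ℝ) (p : X) :
    TangentSpace I p :=
  Classical.epsilon fun v : TangentSpace I p =>
    ∀ w : TangentSpace I p, g p v w = differential I τ p w

/-- The Riemannianization `g^R_τ = (2 / ‖∇τ‖²) dτ² + g`, where `‖V‖² = |g(V, V)|`. -/
def riemannianize (I : ModelWithCorners ℝ E H) (g : TensorField2 I X) (τ : X → ℝ) :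
    TensorField2 I X := fun p v w =>
  2 / |g p (metricGradient I g τ p) (metricGradient I g τ p)| *
    (differential I τ p v * differential I τ p w) + g p v w

/-- Future-pointing causal vectors of the Lorentzian form `g`, time-oriented by the timelike vector
field `T` (such a vector is nonzero because `g(T, v) < 0`). -/
def IsFutureCausal (I : ModelWithCorners ℝ E H) (g : TensorField2 I X)
    (T : ∀ p : X, TangentSpace I p) (p : X) (v : TangentSpace I p) : Prop :=
  g p v v ≤ 0 ∧ g p (T p) v < 0

/-- Past-pointing causal vectors. -/
def IsPastCausal (I : ModelWithCorners ℝ E H) (g : TensorField2 I X)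
    (T : ∀ p : X, TangentSpace I p) (p : X) (v : TangentSpace I p) : Prop :=
  g p v v ≤ 0 ∧ 0 < g p (T p) v

/-- Piecewise causal curves: each smooth piece is future-directed causal, or past-directed causal,
or constant. -/
def IsPiecewiseCausal (I : ModelWithCorners ℝ E H) (g : TensorField2 I X)
    (T : ∀ p : X, TangentSpace I p) (U : Set X) (γ : ℝ → X) (m : ℕ) (s : ℕ → ℝ) : Prop :=
  IsPiecewiseSmooth I U γ m s ∧ ∀ i < m,
    (∀ t ∈ Icc (s i) (s (i + 1)),
      IsFutureCausal I g T (γ t) (velocity I γ (s i) (s (i + 1)) t)) ∨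
    (∀ t ∈ Icc (s i) (s (i + 1)),
      IsPastCausal I g T (γ t) (velocity I γ (s i) (s (i + 1)) t)) ∨
    (∀ t ∈ Icc (s i) (s (i + 1)), γ t = γ (s i))

/-- The null length `∑ |τ(x_{i+1}) - τ(x_i)|` over the break points `x_i = γ (s i)`. -/
def nullLength (τ : X → ℝ) (γ : ℝ → X) (m : ℕ) (s : ℕ → ℝ) : ℝ :=
  ∑ i ∈ Finset.range m, |τ (γ (s (i + 1))) - τ (γ (s i))|

/-- The null distance of the spacetime `(U, g)`, time-oriented by `T`, induced by `τ`: the infimum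
of the null lengths of the piecewise causal curves in `U` from `p` to `q`. -/
def nullDist (I : ModelWithCorners ℝ E H) (g : TensorField2 I X)
    (T : ∀ p : X, TangentSpace I p) (U : Set X) (τ : X → ℝ) (p q : X) : ℝ≥0∞ :=
  ⨅ (γ : ℝ → X) (m : ℕ) (s : ℕ → ℝ) (_ : IsPiecewiseCausal I g T U γ m s)
    (_ : γ (s 0) = p) (_ : γ (s m) = q), ENNReal.ofReal (nullLength τ γ m s)

end General

/-! ### Generalized Robertson-Walker spacetimes -/

/-- The data of a GRW spacetime `(a, b) ×_f S` over the smooth `n`-manifold `S`: the endpoints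
`-∞ ≤ a < b ≤ ∞`, a smooth positive warping function `f` on `(a, b)` (its values elsewhere play no
role), and a smooth Riemannian metric `h` on `S`. -/
structure GRWSpacetime (n : ℕ) (S : Type*) [TopologicalSpace S]
    [ChartedSpace (EuclideanSpace ℝ (Fin n)) S] [IsManifold (𝓡 n) ∞ S] where
  a : EReal
  b : EReal
  a_lt_b : a < b
  f : ℝ → ℝ
  f_smooth : ContDiffOn ℝ ∞ f {t : ℝ | a < t ∧ t < b}
  f_pos : ∀ t : ℝ, a < t → t < b → 0 < f t
  h : ContMDiffRiemannianMetric (𝓡 n) ∞ (EuclideanSpace ℝ (Fin n))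
    (fun x : S => TangentSpace (𝓡 n) x)

namespace GRWSpacetime

variable {n : ℕ} {S : Type*} [TopologicalSpace S]
  [ChartedSpace (EuclideanSpace ℝ (Fin n)) S] [IsManifold (𝓡 n) ∞ S]

/-- The model of the product manifold `ℝ × S`. -/
abbrev model (n : ℕ) : ModelWithCorners ℝ (ℝ × EuclideanSpace ℝ (Fin n))
    (ModelProd ℝ (EuclideanSpace ℝ (Fin n))) :=
  𝓘(ℝ, ℝ).prod (𝓡 n)

/-- The time interval `I = (a, b)`. -/
def interval (G : GRWSpacetime n S) : Set ℝ := {t : ℝ | G.a < t ∧ t < G.b}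

/-- The underlying manifold `M = I × S`, as an open subset of `ℝ × S`. -/
def carrier (G : GRWSpacetime n S) : Set (ℝ × S) := {p | p.1 ∈ G.interval}

/-- The spacetime metric `g = -dt² + f(t)² h`. -/
def metric (G : GRWSpacetime n S) : TensorField2 (model n) (ℝ × S) := fun p v w =>
  let dt : TangentSpace (model n) p →L[ℝ] ℝ := differential (model n) Prod.fst p
  let dπ : TangentSpace (model n) p →L[ℝ] TangentSpace (𝓡 n) p.2 :=
    mfderiv (model n) (𝓡 n) Prod.snd p
  G.f p.1 ^ 2 * G.h.inner p.2 (dπ v) (dπ w) - dt v * dt w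

/-- The coordinate vector field `∂_t`, which defines the time orientation. -/
def timeField (n : ℕ) (S : Type*) [TopologicalSpace S]
    [ChartedSpace (EuclideanSpace ℝ (Fin n)) S] (p : ℝ × S) : TangentSpace (model n) p :=
  ((1 : ℝ), (0 : EuclideanSpace ℝ (Fin n)))

/-- The Riemannian distance `d_S` of `(S, h)`. -/
def spaceDist (G : GRWSpacetime n S) (x y : S) : ℝ≥0∞ :=
  riemDist (𝓡 n) (fun x v w => G.h.inner x v w) univ x y

/-- The Riemannianized distance `d^R_τ`. -/
def riemannianizedDist (G : GRWSpacetime n S) (τ : ℝ × S → ℝ) (p q : ℝ × S) : ℝ≥0∞ :=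
  riemDist (model n) (riemannianize (model n) G.metric τ) G.carrier p q

/-- Piecewise vertical-or-horizontal curves. -/
def IsPVH (G : GRWSpacetime n S) (γ : ℝ → ℝ × S) (m : ℕ) (s : ℕ → ℝ) : Prop :=
  IsPiecewiseSmooth (model n) G.carrier γ m s ∧ ∀ i < m,
    (∀ t ∈ Icc (s i) (s (i + 1)), (γ t).2 = (γ (s i)).2) ∨
    (∀ t ∈ Icc (s i) (s (i + 1)), (γ t).1 = (γ (s i)).1)

/-- The elevator distance `d^E_τ`: the infimum of the Riemannianized lengths of the piecewise
vertical-or-horizontal curves from `p` to `q`. -/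
def elevatorDist (G : GRWSpacetime n S) (τ : ℝ × S → ℝ) (p q : ℝ × S) : ℝ≥0∞ :=
  ⨅ (γ : ℝ → ℝ × S) (m : ℕ) (s : ℕ → ℝ) (_ : G.IsPVH γ m s)
    (_ : γ (s 0) = p) (_ : γ (s m) = q),
    arcLength (model n) (riemannianize (model n) G.metric τ) γ m s

/-- The null distance `d̂_τ`. -/
def nullDistance (G : GRWSpacetime n S) (τ : ℝ × S → ℝ) (p q : ℝ × S) : ℝ≥0∞ :=
  nullDist (model n) G.metric (timeField n S) G.carrier τ p q

/-! ### The faithfulness properties (F1)-(F6) -/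

/-- `A_J = inf {f(t) : t ∈ J}`. -/
def warpInf (G : GRWSpacetime n S) (J : Set ℝ) : ℝ≥0∞ := ⨅ t ∈ J, ENNReal.ofReal (G.f t)

/-- The vertical exit cost `E_{(t₁,t₂)}(t_p, t_q)`, for `a ≤ t₁ < t₂ ≤ b`. An endpoint `t₁ > a` or
`t₂ < b` is automatically a real number. -/
def exitCost (G : GRWSpacetime n S) (t₁ t₂ : EReal) (tp tq : ℝ) : ℝ≥0∞ :=
  open Classical in
  if G.a < t₁ then
    if t₂ < G.b then
      ENNReal.ofReal (min (tp + tq - 2 * t₁.toReal) (2 * t₂.toReal - tp - tq))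
    else ENNReal.ofReal (tp + tq - 2 * t₁.toReal)
  else
    if t₂ < G.b then ENNReal.ofReal (2 * t₂.toReal - tp - tq)
    else ⊤

/-- (F1) with constant `C`. -/
def F1 (G : GRWSpacetime n S) (d : ℝ × S → ℝ × S → ℝ≥0∞) (C : ℝ) : Prop :=
  0 < C ∧ ∀ p ∈ G.carrier, ∀ q ∈ G.carrier, p.2 = q.2 →
    ENNReal.ofReal (C * |q.1 - p.1|) ≤ d p q

/-- (F2) with constant `C`. -/
def F2 (G : GRWSpacetime n S) (d : ℝ × S → ℝ × S → ℝ≥0∞) (C : ℝ) : Prop :=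
  0 < C ∧ ∀ p ∈ G.carrier, ∀ q ∈ G.carrier, p.2 = q.2 →
    d p q ≤ ENNReal.ofReal (C * |q.1 - p.1|)

/-- (F3) with constant `C`. -/
def F3 (G : GRWSpacetime n S) (d : ℝ × S → ℝ × S → ℝ≥0∞) (C : ℝ) : Prop :=
  0 < C ∧ ∀ p ∈ G.carrier, ∀ q ∈ G.carrier, p.1 = q.1 →
    d p q ≤ ENNReal.ofReal C * ENNReal.ofReal (G.f p.1) * G.spaceDist p.2 q.2

/-- (F4) with constant `C`. -/
def F4 (G : GRWSpacetime n S) (d : ℝ × S → ℝ × S → ℝ≥0∞) (C : ℝ) : Prop :=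
  0 < C ∧ ∀ p ∈ G.carrier, ∀ q ∈ G.carrier, ∀ c ∈ G.interval,
    d p q ≤ ENNReal.ofReal C * (ENNReal.ofReal |p.1 - c|
      + ENNReal.ofReal (G.f c) * G.spaceDist p.2 q.2 + ENNReal.ofReal |q.1 - c|)

/-- (F5) with constant `C`. -/
def F5 (G : GRWSpacetime n S) (d : ℝ × S → ℝ × S → ℝ≥0∞) (C : ℝ) : Prop :=
  0 < C ∧ ∀ p ∈ G.carrier, ∀ q ∈ G.carrier,
    ENNReal.ofReal C * G.warpInf G.interval * G.spaceDist p.2 q.2 ≤ d p q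

/-- (F6) with constant `C`. -/
def F6 (G : GRWSpacetime n S) (d : ℝ × S → ℝ × S → ℝ≥0∞) (C : ℝ) : Prop :=
  0 < C ∧ ∀ t₁ t₂ : EReal, G.a ≤ t₁ → t₁ < t₂ → t₂ ≤ G.b →
    ∀ p q : ℝ × S, t₁ < p.1 → p.1 < t₂ → t₁ < q.1 → q.1 < t₂ →
      ENNReal.ofReal C * min (G.exitCost t₁ t₂ p.1 q.1)
        (G.warpInf {t : ℝ | t₁ < t ∧ t < t₂} * G.spaceDist p.2 q.2) ≤ d p q

/-- All of (F1)-(F6), with constants `C₁, …, C₆`. -/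
def Faithful (G : GRWSpacetime n S) (d : ℝ × S → ℝ × S → ℝ≥0∞) (C₁ C₂ C₃ C₄ C₅ C₆ : ℝ) : Prop :=
  G.F1 d C₁ ∧ G.F2 d C₂ ∧ G.F3 d C₃ ∧ G.F4 d C₄ ∧ G.F5 d C₅ ∧ G.F6 d C₆

end GRWSpacetime

end

/-! For a function of time, `∇τ = -φ' ∂_t`, so `‖∇τ‖² = φ'²` cancels the factor in `dτ² = φ'² dt²`
and the Riemannianized metric is `dt² + f² h` whatever `φ` is. This gives the independence of `τ` in
(a) and (b).

The lower bounds (F1), (F5), (F6) have one source, `IsBoundedBelow`: every piece of a competing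
curve costs at least `C ∫ |t'|` and at least `C ∫ f |σ'|`. For the Riemannianized length both are
immediate from `√(t'² + f² |σ'|²)`. For the null length, causality gives `f |σ'| ≤ |t'|`, while `t`
is monotone or constant on a piece, so that `∫ |t'| = |Δt| ≤ |Δφ| / C`. In (F6) a curve either stays
in the time window, where `f` is at least its infimum there, or leaves it and pays the exit cost in
time variation.

The upper bounds come from explicit curves: vertical segments for (F2), curves in a slice for (F3),
and both joined by the triangle inequality for (F4). Elevator curves bound the Riemannianized
distance as well. Slice curves are not causal in general, so for the null distance they are replaced
by fine causal zigzags whose slope approximates `f |σ'|` (`nullDistance_zigzag_le`);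
`le_lintegral_of_locally` adds up these local estimates.

Conversely, the null distance between points of one vertical line is exactly `|φ t₁ - φ t₀|`, so
(F1) and (F2) bound the difference quotients of `φ` and hence `φ'`. -/

noncomputable section

/-! ### Velocities under translation, restriction and composition -/

section General

variable {E H X : Type*} [NormedAddCommGroup E] [NormedSpace ℝ E] [TopologicalSpace H]
  [TopologicalSpace X] [ChartedSpace H X] {I : ModelWithCorners ℝ E H}

/-- The data `(γ t, γ' t)` at corresponding times of a curve and of a translate of it agree. -/
theorem apply_velocity_of_translate {α : Type*} (F : ∀ p : X, TangentSpace I p → α)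
    {γ γ' : ℝ → X} {u v k : ℝ} (h : ∀ r ∈ Icc (u + k) (v + k), γ' r = γ (r - k)) (huv : u < v)
    (hγ : MDifferentiableOn 𝓘(ℝ, ℝ) I γ (Icc u v)) {t : ℝ} (ht : t ∈ Icc (u + k) (v + k)) :
    F (γ' t) (velocity I γ' (u + k) (v + k) t) = F (γ (t - k)) (velocity I γ u v (t - k)) := by
  have hmaps : MapsTo (fun r : ℝ => r - k) (Icc (u + k) (v + k)) (Icc u v) := by
    intro r hr
    exact ⟨by linarith [hr.1], by linarith [hr.2]⟩
  have hd : HasMFDerivWithinAt 𝓘(ℝ, ℝ) 𝓘(ℝ, ℝ) (fun r : ℝ => r - k) (Icc (u + k) (v + k)) t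
      (ContinuousLinearMap.id ℝ ℝ) :=
    (((hasFDerivAt_id (𝕜 := ℝ) t).sub_const k).hasFDerivWithinAt).hasMFDerivWithinAt
  have hc := (((hγ (t - k) (hmaps ht)).hasMFDerivWithinAt).comp t hd (u := Icc u v) hmaps).congr_of_eventuallyEq
    (f₁ := γ') (Filter.eventuallyEq_of_mem self_mem_nhdsWithin h) (h t ht)
  have huq : UniqueMDiffWithinAt 𝓘(ℝ, ℝ) (Icc (u + k) (v + k)) t :=
    (uniqueDiffOn_Icc (by linarith) _ ht).uniqueMDiffWithinAt
  have hv : (velocity I γ' (u + k) (v + k) t : E) = (velocity I γ u v (t - k) : E) :=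
    congrArg (fun L : ℝ →L[ℝ] E => L 1) (hc.mfderivWithin huq)
  have key : ∀ (F : X → E → α) (p q : X) (v w : E), p = q → v = w → F p v = F q w := by
    rintro F p _ v _ rfl rfl
    rfl
  exact key F _ _ _ _ (h t ht) hv

theorem velocity_of_subset {γ : ℝ → X} {u v x y : ℝ} (hxy : x < y) (hsub : Icc x y ⊆ Icc u v)
    {t : ℝ} (ht : t ∈ Icc x y) (hγ : MDifferentiableWithinAt 𝓘(ℝ, ℝ) I γ (Icc u v) t) :
    velocity I γ x y t = velocity I γ u v t := by
  unfold velocity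
  rw [mfderivWithin_subset hsub (uniqueDiffOn_Icc hxy _ ht).uniqueMDiffWithinAt hγ]

end General

/-- A curve in `X` composed with a differentiable map has the image velocity. -/
theorem mfderiv_velocity {E H X E' H' X' : Type*} [NormedAddCommGroup E] [NormedSpace ℝ E]
    [TopologicalSpace H] [TopologicalSpace X] [ChartedSpace H X] {I : ModelWithCorners ℝ E H}
    [NormedAddCommGroup E'] [NormedSpace ℝ E']
    [TopologicalSpace H'] [TopologicalSpace X'] [ChartedSpace H' X'] {I' : ModelWithCorners ℝ E' H'}
    {γ : ℝ → X} {F : X → X'} {u v t : ℝ} (huv : u < v) (ht : t ∈ Icc u v)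
    (hγ : MDifferentiableWithinAt 𝓘(ℝ, ℝ) I γ (Icc u v) t) (hF : MDifferentiableAt I I' F (γ t)) :
    mfderiv I I' F (γ t) (velocity I γ u v t) = velocity I' (F ∘ γ) u v t := by
  unfold velocity
  rw [mfderiv_comp_mfderivWithin t hF hγ (uniqueDiffOn_Icc huv _ ht).uniqueMDiffWithinAt]
  rfl

/-! ### The spacetime metric and its Riemannianization in components -/

namespace GRWSpacetime

variable {n : ℕ} {S : Type*} [TopologicalSpace S]
  [ChartedSpace (EuclideanSpace ℝ (Fin n)) S] [IsManifold (𝓡 n) ∞ S]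

/-- The `h`-speed at time `t` of a curve in `S` considered on `[u, v]`. -/
def speed (G : GRWSpacetime n S) (σ : ℝ → S) (u v t : ℝ) : ℝ :=
  √(G.h.inner (σ t) (velocity (𝓡 n) σ u v t) (velocity (𝓡 n) σ u v t))

theorem inner_self_nonneg (G : GRWSpacetime n S) (x : S) (v : TangentSpace (𝓡 n) x) :
    0 ≤ G.h.inner x v v := by
  by_cases hv : v = 0
  · simp [hv]
  · exact (G.h.pos x v hv).le

theorem speed_nonneg (G : GRWSpacetime n S) (σ : ℝ → S) (u v t : ℝ) : 0 ≤ G.speed σ u v t :=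
  Real.sqrt_nonneg _

theorem speed_sq (G : GRWSpacetime n S) (σ : ℝ → S) (u v t : ℝ) :
    G.speed σ u v t ^ 2 = G.h.inner (σ t) (velocity (𝓡 n) σ u v t) (velocity (𝓡 n) σ u v t) :=
  Real.sq_sqrt (G.inner_self_nonneg _ _)

theorem isOpen_interval (G : GRWSpacetime n S) : IsOpen G.interval := by
  have h : G.interval = (fun t : ℝ => (t : EReal)) ⁻¹' Ioo G.a G.b := rfl
  rw [h]
  exact isOpen_Ioo.preimage continuous_coe_real_ereal

theorem ordConnected_interval (G : GRWSpacetime n S) : G.interval.OrdConnected := by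
  refine ⟨fun x hx y hy z hz => ⟨lt_of_lt_of_le hx.1 ?_, lt_of_le_of_lt ?_ hy.2⟩⟩
  · exact_mod_cast hz.1
  · exact_mod_cast hz.2

theorem isOpen_carrier (G : GRWSpacetime n S) : IsOpen G.carrier :=
  G.isOpen_interval.preimage continuous_fst

omit [IsManifold (𝓡 n) ∞ S] in
theorem differential_fst_timeField (p : ℝ × S) :
    differential (model n) (Prod.fst : ℝ × S → ℝ) p (timeField n S p) = 1 := by
  unfold differential
  rw [mfderiv_fst]
  rfl

omit [IsManifold (𝓡 n) ∞ S] in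
theorem mfderiv_snd_timeField (p : ℝ × S) :
    mfderiv (model n) (𝓡 n) (Prod.snd : ℝ × S → S) p (timeField n S p) = 0 := by
  rw [mfderiv_snd]
  rfl

theorem metric_apply (G : GRWSpacetime n S) (p : ℝ × S) (v w : TangentSpace (model n) p) :
    G.metric p v w = G.f p.1 ^ 2 * G.h.inner p.2 (mfderiv (model n) (𝓡 n) Prod.snd p v)
      (mfderiv (model n) (𝓡 n) Prod.snd p w) -
      differential (model n) (Prod.fst : ℝ × S → ℝ) p v * differential (model n) Prod.fst p w := rfl

/-- The gradient of a function of time has squared `g`-norm `-(φ')²`. -/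
theorem metric_metricGradient (G : GRWSpacetime n S) {τ : ℝ × S → ℝ} {p : ℝ × S} {c : ℝ}
    (hτ : ∀ w, differential (model n) τ p w = c * differential (model n) Prod.fst p w) :
    G.metric p (metricGradient (model n) G.metric τ p) (metricGradient (model n) G.metric τ p) =
      -c ^ 2 := by
  have hex : ∃ v : TangentSpace (model n) p, ∀ w, G.metric p v w = differential (model n) τ p w := by
    refine ⟨(-c) • timeField n S p, fun w => ?_⟩
    rw [hτ, metric_apply, (differential (model n) Prod.fst p).map_smul, ContinuousLinearMap.map_smul,
      mfderiv_snd_timeField, differential_fst_timeField]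
    simp
  have hs := Classical.epsilon_spec hex
  change ∀ w, G.metric p (metricGradient (model n) G.metric τ p) w = _ at hs
  -- The chosen gradient need not be identified: testing its defining property on `∂_t` gives its
  -- time component, and testing on `V` itself kills the spatial term.
  set V := metricGradient (model n) G.metric τ p
  have h1 : differential (model n) Prod.fst p V = -c := by
    have := hs (timeField n S p)
    rw [hτ, metric_apply, mfderiv_snd_timeField, differential_fst_timeField, map_zero] at this
    linarith
  have h2 : G.f p.1 ^ 2 * G.h.inner p.2 (mfderiv (model n) (𝓡 n) Prod.snd p V)
      (mfderiv (model n) (𝓡 n) Prod.snd p V) = 0 := by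
    have := hs V
    rw [hτ, metric_apply, h1] at this
    linarith
  rw [metric_apply, h2, h1]
  ring

/-- The Riemannianization of a function of time is `dt² + f² h`. -/
theorem riemannianize_eq (G : GRWSpacetime n S) {τ : ℝ × S → ℝ} {p : ℝ × S} {c : ℝ} (hc : c ≠ 0)
    (hτ : ∀ w, differential (model n) τ p w = c * differential (model n) Prod.fst p w)
    (v : TangentSpace (model n) p) :
    riemannianize (model n) G.metric τ p v v = differential (model n) Prod.fst p v ^ 2 +
      G.f p.1 ^ 2 * G.h.inner p.2 (mfderiv (model n) (𝓡 n) Prod.snd p v)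
      (mfderiv (model n) (𝓡 n) Prod.snd p v) := by
  unfold riemannianize
  rw [G.metric_metricGradient hτ, hτ, metric_apply, abs_neg, abs_of_nonneg (sq_nonneg c)]
  field_simp
  ring

/-- The carrier is open, so prescribing `τ` there alone still determines its germ at `p`, and the
chain rule for `φ ∘ Prod.fst` applies. -/
theorem differential_of_eq_time (G : GRWSpacetime n S) {φ : ℝ → ℝ} {τ : ℝ × S → ℝ}
    (hτ : ∀ p ∈ G.carrier, τ p = φ p.1) {p : ℝ × S} (hp : p ∈ G.carrier)
    (hφ : DifferentiableAt ℝ φ p.1) (w : TangentSpace (model n) p) :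
    differential (model n) τ p w = deriv φ p.1 * differential (model n) Prod.fst p w := by
  have he : τ =ᶠ[nhds p] φ ∘ Prod.fst :=
    Filter.eventuallyEq_of_mem (G.isOpen_carrier.mem_nhds hp) fun q hq => hτ q hq
  have hc : mfderiv (model n) 𝓘(ℝ, ℝ) (φ ∘ (Prod.fst : ℝ × S → ℝ)) p =
      (mfderiv 𝓘(ℝ, ℝ) 𝓘(ℝ, ℝ) φ p.1).comp (mfderiv (model n) 𝓘(ℝ, ℝ) Prod.fst p) :=
    mfderiv_comp p hφ.mdifferentiableAt mdifferentiableAt_fst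
  unfold differential
  have h1 := he.mfderiv_eq (I := model n) (I' := 𝓘(ℝ, ℝ))
  have h2 : (mfderiv (model n) 𝓘(ℝ, ℝ) τ p : (ℝ × EuclideanSpace ℝ (Fin n)) →L[ℝ] ℝ) =
    (fderiv ℝ φ p.1).comp (mfderiv (model n) 𝓘(ℝ, ℝ) (Prod.fst : ℝ × S → ℝ) p) := by
    rw [← mfderiv_eq_fderiv]
    exact h1.trans hc
  have h3 := congrArg (fun L : (ℝ × EuclideanSpace ℝ (Fin n)) →L[ℝ] ℝ => L w) h2
  refine h3.trans ?_
  change fderiv ℝ φ p.1 _ = _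
  rw [fderiv_eq_smul_deriv, smul_eq_mul, mul_comm]
  rfl

end GRWSpacetime

namespace GRWSpacetime

variable {n : ℕ} {S : Type*} [TopologicalSpace S]
  [ChartedSpace (EuclideanSpace ℝ (Fin n)) S] [IsManifold (𝓡 n) ∞ S]

/-! ### Time and space components of the velocity; speed of the spatial part -/

section Curve

variable {γ : ℝ → ℝ × S} {u v t : ℝ}

omit [IsManifold (𝓡 n) ∞ S] in
theorem contDiffOn_fst (hγ : ContMDiffOn 𝓘(ℝ, ℝ) (model n) ∞ γ (Icc u v)) :
    ContDiffOn ℝ ∞ (fun r => (γ r).1) (Icc u v) :=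
  (contMDiff_fst.comp_contMDiffOn hγ).contDiffOn

omit [IsManifold (𝓡 n) ∞ S] in
theorem contMDiffOn_snd (hγ : ContMDiffOn 𝓘(ℝ, ℝ) (model n) ∞ γ (Icc u v)) :
    ContMDiffOn 𝓘(ℝ, ℝ) (𝓡 n) ∞ (fun r => (γ r).2) (Icc u v) :=
  contMDiff_snd.comp_contMDiffOn hγ

omit [IsManifold (𝓡 n) ∞ S] in
theorem differential_fst_velocity (hγ : ContMDiffOn 𝓘(ℝ, ℝ) (model n) ∞ γ (Icc u v))
    (huv : u < v) (ht : t ∈ Icc u v) :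
    differential (model n) (Prod.fst : ℝ × S → ℝ) (γ t) (velocity (model n) γ u v t) =
      derivWithin (fun r => (γ r).1) (Icc u v) t := by
  have h := mfderiv_velocity (F := (Prod.fst : ℝ × S → ℝ)) (I' := 𝓘(ℝ, ℝ)) huv ht
    ((hγ t ht).mdifferentiableWithinAt (by simp)) mdifferentiableAt_fst
  refine h.trans ?_
  unfold velocity
  rw [mfderivWithin_eq_fderivWithin]
  exact fderivWithin_derivWithin

omit [IsManifold (𝓡 n) ∞ S] in
theorem mfderiv_snd_velocity (hγ : ContMDiffOn 𝓘(ℝ, ℝ) (model n) ∞ γ (Icc u v))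
    (huv : u < v) (ht : t ∈ Icc u v) :
    mfderiv (model n) (𝓡 n) (Prod.snd : ℝ × S → S) (γ t) (velocity (model n) γ u v t) =
      velocity (𝓡 n) (fun r => (γ r).2) u v t :=
  mfderiv_velocity (F := (Prod.snd : ℝ × S → S)) (I' := 𝓡 n) huv ht
    ((hγ t ht).mdifferentiableWithinAt (by simp)) mdifferentiableAt_snd

theorem metric_velocity (G : GRWSpacetime n S)
    (hγ : ContMDiffOn 𝓘(ℝ, ℝ) (model n) ∞ γ (Icc u v)) (huv : u < v) (ht : t ∈ Icc u v) :
    G.metric (γ t) (velocity (model n) γ u v t) (velocity (model n) γ u v t) =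
      (G.f (γ t).1 * G.speed (fun r => (γ r).2) u v t) ^ 2 -
        derivWithin (fun r => (γ r).1) (Icc u v) t ^ 2 := by
  rw [metric_apply, differential_fst_velocity hγ huv ht, mfderiv_snd_velocity hγ huv ht, mul_pow,
    speed_sq, ← sq]

theorem metric_timeField_velocity (G : GRWSpacetime n S)
    (hγ : ContMDiffOn 𝓘(ℝ, ℝ) (model n) ∞ γ (Icc u v)) (huv : u < v) (ht : t ∈ Icc u v) :
    G.metric (γ t) (timeField n S (γ t)) (velocity (model n) γ u v t) =
      -derivWithin (fun r => (γ r).1) (Icc u v) t := by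
  rw [metric_apply, differential_fst_velocity hγ huv ht, mfderiv_snd_timeField, map_zero,
    differential_fst_timeField]
  simp

theorem riemannianize_velocity (G : GRWSpacetime n S) {φ : ℝ → ℝ} {τ : ℝ × S → ℝ}
    (hτ : ∀ p ∈ G.carrier, τ p = φ p.1) (hφ : ∀ r ∈ G.interval, 0 < deriv φ r)
    (hγ : ContMDiffOn 𝓘(ℝ, ℝ) (model n) ∞ γ (Icc u v)) (huv : u < v) (ht : t ∈ Icc u v)
    (hmem : γ t ∈ G.carrier) :
    riemannianize (model n) G.metric τ (γ t) (velocity (model n) γ u v t)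
        (velocity (model n) γ u v t) =
      derivWithin (fun r => (γ r).1) (Icc u v) t ^ 2 +
        (G.f (γ t).1 * G.speed (fun r => (γ r).2) u v t) ^ 2 := by
  -- `deriv` takes the value zero where differentiability fails, so positivity already provides
  -- differentiability of `φ`.
  have h0 := hφ _ hmem
  rw [G.riemannianize_eq h0.ne' (G.differential_of_eq_time hτ hmem
    (differentiableAt_of_deriv_ne_zero h0.ne')), differential_fst_velocity hγ huv ht,
    mfderiv_snd_velocity hγ huv ht, mul_pow, speed_sq]

end Curve

/-- The velocity is the image of the unit field under the tangent map of `σ`, hence continuous into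
the tangent bundle; pairing it with itself by the continuous metric stays continuous. -/
theorem continuousOn_speed (G : GRWSpacetime n S) {σ : ℝ → S} {u v : ℝ} (huv : u < v)
    (hσ : ContMDiffOn 𝓘(ℝ, ℝ) (𝓡 n) ∞ σ (Icc u v)) : ContinuousOn (G.speed σ u v) (Icc u v) := by
  have hv : ContMDiffOn 𝓘(ℝ, ℝ) (𝓡 n).tangent 0
      (fun t => (TotalSpace.mk' (EuclideanSpace ℝ (Fin n)) (σ t) (velocity (𝓡 n) σ u v t) :
        TangentBundle (𝓡 n) S)) (Icc u v) := by
    have h1 : ContMDiffOn 𝓘(ℝ, ℝ).tangent (𝓡 n).tangent 0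
        (tangentMapWithin 𝓘(ℝ, ℝ) (𝓡 n) σ (Icc u v))
        (Bundle.TotalSpace.proj ⁻¹' (Icc u v)) :=
      hσ.contMDiffOn_tangentMapWithin (by simp) (uniqueDiffOn_Icc huv).uniqueMDiffOn
    have h2 : ContMDiff 𝓘(ℝ, ℝ) 𝓘(ℝ, ℝ).tangent 0
        (fun t : ℝ => (TotalSpace.mk' ℝ t (1 : ℝ) : TangentBundle 𝓘(ℝ, ℝ) ℝ)) :=
      contMDiff_vectorSpace_iff_contDiff.2 contDiff_const
    exact h1.comp h2.contMDiffOn (fun t ht => ht)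
  have hψ : ContMDiffOn 𝓘(ℝ, ℝ) ((𝓡 n).prod 𝓘(ℝ, EuclideanSpace ℝ (Fin n) →L[ℝ]
      EuclideanSpace ℝ (Fin n) →L[ℝ] ℝ)) 0
      (fun t => TotalSpace.mk' (EuclideanSpace ℝ (Fin n) →L[ℝ] EuclideanSpace ℝ (Fin n) →L[ℝ] ℝ)
        (E := fun x : S => TangentSpace (𝓡 n) x →L[ℝ] TangentSpace (𝓡 n) x →L[ℝ] ℝ)
        (σ t) (G.h.inner (σ t))) (Icc u v) :=
    (G.h.contMDiff.of_le (by simp)).comp_contMDiffOn (hσ.of_le (by simp))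
  have h := ContMDiffOn.clm_bundle_apply₂ (E₃ := Bundle.Trivial S ℝ) (F₃ := ℝ) hψ hv hv
  have h' : ContinuousOn (fun t => G.h.inner (σ t) (velocity (𝓡 n) σ u v t)
      (velocity (𝓡 n) σ u v t)) (Icc u v) := by
    intro t ht
    have := h t ht
    simp only [contMDiffWithinAt_totalSpace] at this
    exact this.2.continuousWithinAt
  exact h'.sqrt

theorem speed_of_subset (G : GRWSpacetime n S) {σ : ℝ → S} {u v x y t : ℝ}
    (hσ : ContMDiffOn 𝓘(ℝ, ℝ) (𝓡 n) ∞ σ (Icc u v)) (hxy : x < y) (hsub : Icc x y ⊆ Icc u v)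
    (ht : t ∈ Icc x y) : G.speed σ x y t = G.speed σ u v t := by
  unfold speed
  rw [velocity_of_subset hxy hsub ht ((hσ t (hsub ht)).mdifferentiableWithinAt (by simp))]

theorem speed_const (G : GRWSpacetime n S) (x : S) (u v t : ℝ) :
    G.speed (fun _ => x) u v t = 0 := by
  have h : velocity (𝓡 n) (fun _ : ℝ => x) u v t = 0 := by
    unfold velocity
    rw [mfderivWithin_const]
    rfl
  unfold speed
  rw [h]
  simp

end GRWSpacetime

/-! ### Distances defined by chains of admissible pieces -/

section ChainDist

variable {X : Type*} {P : (ℝ → X) → ℝ → ℝ → Prop} {c : (ℝ → X) → ℝ → ℝ → ℝ≥0∞}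

/-- The infimum of the total costs of the curves from `p` to `q` made of finitely many admissible
pieces, where `P γ u v` says that `γ` restricted to `[u, v]` is an admissible piece, of cost
`c γ u v`. -/
def chainDist (P : (ℝ → X) → ℝ → ℝ → Prop) (c : (ℝ → X) → ℝ → ℝ → ℝ≥0∞) (p q : X) : ℝ≥0∞ :=
  ⨅ (γ : ℝ → X) (m : ℕ) (s : ℕ → ℝ) (_ : 0 < m ∧ ∀ i < m, s i < s (i + 1) ∧ P γ (s i) (s (i + 1)))
    (_ : γ (s 0) = p) (_ : γ (s m) = q), ∑ i ∈ Finset.range m, c γ (s i) (s (i + 1))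

/-- Admissibility and cost of a piece depend only on its restriction to its parameter interval,
up to translation of the parameter. -/
def IsTranslationInvariant (P : (ℝ → X) → ℝ → ℝ → Prop) (c : (ℝ → X) → ℝ → ℝ → ℝ≥0∞) : Prop :=
  ∀ (γ γ' : ℝ → X) (u v k : ℝ), u < v → (∀ r ∈ Icc (u + k) (v + k), γ' r = γ (r - k)) → P γ u v →
    P γ' (u + k) (v + k) ∧ c γ' (u + k) (v + k) = c γ u v

theorem chainDist_le_of_piece {γ : ℝ → X} {u v : ℝ} (huv : u < v) (h : P γ u v) :
    chainDist P c (γ u) (γ v) ≤ c γ u v := by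
  unfold chainDist
  refine iInf_le_of_le γ (iInf_le_of_le 1 (iInf_le_of_le (fun i => if i = 0 then u else v)
    (iInf_le_of_le ⟨one_pos, ?_⟩ (iInf_le_of_le ?_ (iInf_le_of_le ?_ ?_)))))
  · intro i hi
    obtain rfl : i = 0 := by omega
    exact ⟨huv, h⟩
  · simp
  · simp
  · simp

/-- Two chains are concatenated after translating the second so that it starts at the parameter
where the first ends; translation invariance preserves its pieces and costs. -/
theorem chainDist_triangle (hPc : IsTranslationInvariant P c) (p q r : X) :
    chainDist P c p r ≤ chainDist P c p q + chainDist P c q r := by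
  conv_rhs => unfold chainDist
  simp only [ENNReal.iInf_add]
  simp only [ENNReal.add_iInf]
  refine le_iInf fun γ₁ => le_iInf fun m₁ => le_iInf fun s₁ => le_iInf fun h₁ => le_iInf fun hp =>
    le_iInf fun hq => le_iInf fun γ₂ => le_iInf fun m₂ => le_iInf fun s₂ => le_iInf fun h₂ =>
    le_iInf fun hq' => le_iInf fun hr => ?_
  set k := s₁ m₁ - s₂ 0 with hk
  set γ : ℝ → X := fun t => if t ≤ s₁ m₁ then γ₁ t else γ₂ (t - k) with hγ
  set s : ℕ → ℝ := fun i => if i ≤ m₁ then s₁ i else s₂ (i - m₁) + k with hs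
  have hmono₁ : ∀ i ≤ m₁, s₁ i ≤ s₁ m₁ := by
    intro i hi
    induction hi using Nat.decreasingInduction with
    | self => exact le_rfl
    | of_succ j hj ih => exact (h₁.2 j hj).1.le.trans ih
  have hmono₂ : ∀ i ≤ m₂, s₂ 0 ≤ s₂ i := by
    intro i hi
    induction i with
    | zero => exact le_rfl
    | succ j ih => exact (ih (by omega)).trans (h₂.2 j (by omega)).1.le
  have hs₁ : ∀ i ≤ m₁, s i = s₁ i := fun i hi => by simp [hs, hi]
  have hs₂ : ∀ j, s (m₁ + j) = s₂ j + k := by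
    intro j
    rcases Nat.eq_zero_or_pos j with rfl | hj
    · simp [hs, hk]
    · have : ¬ m₁ + j ≤ m₁ := by omega
      simp [hs, this]
  have hγ₁ : ∀ t ≤ s₁ m₁, γ t = γ₁ t := fun t ht => by simp [hγ, ht]
  -- At the junction `t = s₁ m₁` the definition uses `γ₁`, but both curves pass through `q` there,
  -- so the second formula holds on the closed half-line.
  have hγ₂ : ∀ t, s₁ m₁ ≤ t → γ t = γ₂ (t - k) := by
    intro t ht
    rcases ht.eq_or_lt with rfl | ht
    · simp [hγ, hk, hq, hq']
    · simp [hγ, not_le.2 ht]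
  have hpiece₁ : ∀ i < m₁, P γ (s i) (s (i + 1)) ∧
      c γ (s i) (s (i + 1)) = c γ₁ (s₁ i) (s₁ (i + 1)) := by
    intro i hi
    have := hPc γ₁ γ (s₁ i) (s₁ (i + 1)) 0 (h₁.2 i hi).1 (fun t ht => by
      rw [add_zero] at ht
      rw [sub_zero, hγ₁ t (ht.2.trans (by simpa using hmono₁ (i + 1) hi))]) (h₁.2 i hi).2
    simpa [hs₁ i hi.le, hs₁ (i + 1) hi] using this
  have hpiece₂ : ∀ j < m₂, P γ (s (m₁ + j)) (s (m₁ + j + 1)) ∧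
      c γ (s (m₁ + j)) (s (m₁ + j + 1)) = c γ₂ (s₂ j) (s₂ (j + 1)) := by
    intro j hj
    have := hPc γ₂ γ (s₂ j) (s₂ (j + 1)) k (h₂.2 j hj).1 (fun t ht => by
      refine hγ₂ t ?_
      have := hmono₂ j hj.le
      linarith [ht.1]) (h₂.2 j hj).2
    rwa [add_assoc, hs₂, hs₂]
  unfold chainDist
  refine iInf_le_of_le γ (iInf_le_of_le (m₁ + m₂) (iInf_le_of_le s
    (iInf_le_of_le ⟨by omega, ?_⟩ (iInf_le_of_le ?_ (iInf_le_of_le ?_ ?_)))))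
  · intro i hi
    rcases lt_or_ge i m₁ with h | h
    · exact ⟨by rw [hs₁ i h.le, hs₁ (i + 1) h]; exact (h₁.2 i h).1, (hpiece₁ i h).1⟩
    · obtain ⟨j, rfl⟩ := Nat.exists_eq_add_of_le h
      refine ⟨?_, (hpiece₂ j (by omega)).1⟩
      rw [add_assoc, hs₂, hs₂]
      linarith [(h₂.2 j (by omega)).1]
  · rw [hs₁ 0 (Nat.zero_le _), hγ₁ _ (hmono₁ 0 (Nat.zero_le _)), hp]
  · rw [hs₂, hγ₂ _ (by linarith [hmono₂ m₂ le_rfl]), add_sub_cancel_right, hr]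
  · rw [Finset.sum_range_add]
    refine add_le_add (Finset.sum_le_sum fun i hi => ?_) (Finset.sum_le_sum fun j hj => ?_)
    · exact (hpiece₁ i (Finset.mem_range.1 hi)).2.le
    · exact (hpiece₂ j (Finset.mem_range.1 hj)).2.le

/-- A function satisfying the triangle inequality is bounded by sums along a chain of points. -/
theorem le_sum_range_of_triangle {d : X → X → ℝ≥0∞} (hd : ∀ p q r, d p r ≤ d p q + d q r)
    (x : ℕ → X) (b : ℕ → ℝ≥0∞) {m : ℕ} (hm : 0 < m) (h : ∀ i < m, d (x i) (x (i + 1)) ≤ b i) :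
    d (x 0) (x m) ≤ ∑ i ∈ Finset.range m, b i := by
  induction m, hm using Nat.le_induction with
  | base => simpa using h 0 one_pos
  | succ k hk ih =>
    rw [Finset.sum_range_succ]
    exact (hd _ _ _).trans (add_le_add (ih fun i hi => h i (by omega)) (h k (by omega)))

end ChainDist

/-- If `d` satisfies the triangle inequality along a curve `x`, then a bound by an integral that
holds locally holds globally. -/
theorem le_lintegral_of_locally {X : Type*} {d : X → X → ℝ≥0∞}
    (hd : ∀ p q r, d p r ≤ d p q + d q r) {x : ℝ → X} {w : ℝ → ℝ≥0∞} {u v : ℝ} (huv : u < v)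
    (hloc : ∀ z ∈ Icc u v, ∃ δ > 0, ∀ r s, r ∈ Icc u v → s ∈ Icc u v → |r - z| < δ → |s - z| < δ →
      r < s → d (x r) (x s) ≤ ∫⁻ t in Ioc r s, w t) :
    d (x u) (x v) ≤ ∫⁻ t in Ioc u v, w t := by
  choose! δ hδ hloc using hloc
  obtain ⟨t, ht0, htm, ⟨m, hm⟩, ht⟩ := exists_monotone_Icc_subset_open_cover_Icc huv.le
    (c := fun z : Icc u v => {r : Icc u v | |(r : ℝ) - z| < δ z})
    (fun z => isOpen_lt (by fun_prop) continuous_const)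
    (fun z _ => mem_iUnion.2 ⟨z, by simpa using hδ z z.2⟩)
  -- Subdivision points may repeat, and `d` is not assumed to vanish on the diagonal; the condition
  -- `u < t k` excludes the degenerate start.
  have key : ∀ k, u < t k → d (x u) (x (t k)) ≤ ∫⁻ r in Ioc u (t k : ℝ), w r := by
    intro k
    induction k with
    | zero => intro h; simp [ht0] at h
    | succ k ih =>
      intro hk
      obtain ⟨z, hz⟩ := ht k
      have hle : t k ≤ t (k + 1) := htm (Nat.le_succ k)
      have h1 : |(t k : ℝ) - z| < δ z := hz ⟨le_rfl, hle⟩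
      have h2 : |(t (k + 1) : ℝ) - z| < δ z := hz ⟨hle, le_rfl⟩
      have step : (t k : ℝ) < t (k + 1) →
          d (x (t k)) (x (t (k + 1))) ≤ ∫⁻ r in Ioc (t k : ℝ) (t (k + 1)), w r :=
        hloc z z.2 _ _ (t k).2 (t (k + 1)).2 h1 h2
      rcases (t k).2.1.eq_or_lt with hu | hu
      · rw [← hu] at step
        exact step hk
      rcases (show (t k : ℝ) ≤ t (k + 1) from hle).eq_or_lt with he | hlt
      · rw [← he]
        exact ih hu
      · rw [← Ioc_union_Ioc_eq_Ioc hu.le hlt.le, lintegral_union measurableSet_Ioc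
          (Ioc_disjoint_Ioc_of_le le_rfl)]
        exact (hd _ _ _).trans (add_le_add (ih hu) (step hlt))
  have := key m (by rw [hm m le_rfl]; exact huv)
  rwa [hm m le_rfl] at this

namespace GRWSpacetime

variable {n : ℕ} {S : Type*} [TopologicalSpace S]
  [ChartedSpace (EuclideanSpace ℝ (Fin n)) S] [IsManifold (𝓡 n) ∞ S]

/-! ### The elevator distance and the null distance as chain distances -/

/-- A smooth vertical or horizontal piece. -/
def IsElevatorPiece (G : GRWSpacetime n S) (γ : ℝ → ℝ × S) (u v : ℝ) : Prop :=
  (ContMDiffOn 𝓘(ℝ, ℝ) (model n) ∞ γ (Icc u v) ∧ MapsTo γ (Icc u v) G.carrier) ∧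
    ((∀ t ∈ Icc u v, (γ t).2 = (γ u).2) ∨ (∀ t ∈ Icc u v, (γ t).1 = (γ u).1))

/-- The length of a smooth piece for the Riemannianized metric. -/
def riemannianizedCost (G : GRWSpacetime n S) (τ : ℝ × S → ℝ) (γ : ℝ → ℝ × S) (u v : ℝ) : ℝ≥0∞ :=
  ∫⁻ t in Icc u v, ENNReal.ofReal (√(riemannianize (model n) G.metric τ (γ t)
    (velocity (model n) γ u v t) (velocity (model n) γ u v t)))

/-- A smooth piece that is future-directed causal, past-directed causal, or constant. -/
def IsCausalPiece (G : GRWSpacetime n S) (γ : ℝ → ℝ × S) (u v : ℝ) : Prop :=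
  (ContMDiffOn 𝓘(ℝ, ℝ) (model n) ∞ γ (Icc u v) ∧ MapsTo γ (Icc u v) G.carrier) ∧
    ((∀ t ∈ Icc u v, IsFutureCausal (model n) G.metric (timeField n S) (γ t)
        (velocity (model n) γ u v t)) ∨
      (∀ t ∈ Icc u v, IsPastCausal (model n) G.metric (timeField n S) (γ t)
        (velocity (model n) γ u v t)) ∨
      (∀ t ∈ Icc u v, γ t = γ u))

theorem elevatorDist_eq_chainDist (G : GRWSpacetime n S) (τ : ℝ × S → ℝ) :
    G.elevatorDist τ = chainDist G.IsElevatorPiece (G.riemannianizedCost τ) := by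
  funext p q
  unfold elevatorDist chainDist
  refine iInf_congr fun γ => iInf_congr fun m => iInf_congr fun s => iInf_congr_Prop ?_ fun _ => rfl
  unfold IsPVH IsPiecewiseSmooth IsElevatorPiece
  exact ⟨fun h => ⟨h.1.1, fun i hi => ⟨(h.1.2 i hi).1, (h.1.2 i hi).2, h.2 i hi⟩⟩,
    fun h => ⟨⟨h.1, fun i hi => ⟨(h.2 i hi).1, (h.2 i hi).2.1⟩⟩, fun i hi => (h.2 i hi).2.2⟩⟩

theorem nullDistance_eq_chainDist (G : GRWSpacetime n S) (τ : ℝ × S → ℝ) :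
    G.nullDistance τ = chainDist G.IsCausalPiece
      (fun γ u v => ENNReal.ofReal |τ (γ v) - τ (γ u)|) := by
  funext p q
  unfold nullDistance nullDist chainDist
  refine iInf_congr fun γ => iInf_congr fun m => iInf_congr fun s => iInf_congr_Prop ?_ fun _ => ?_
  · unfold IsPiecewiseCausal IsPiecewiseSmooth IsCausalPiece
    exact ⟨fun h => ⟨h.1.1, fun i hi => ⟨(h.1.2 i hi).1, (h.1.2 i hi).2, h.2 i hi⟩⟩,
      fun h => ⟨⟨h.1, fun i hi => ⟨(h.2 i hi).1, (h.2 i hi).2.1⟩⟩, fun i hi => (h.2 i hi).2.2⟩⟩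
  · unfold nullLength
    rw [ENNReal.ofReal_sum_of_nonneg fun i _ => abs_nonneg _]

section Translation

variable {γ γ' : ℝ → ℝ × S} {u v k : ℝ}

omit [IsManifold (𝓡 n) ∞ S] in
theorem contMDiffOn_of_translate (h : ∀ r ∈ Icc (u + k) (v + k), γ' r = γ (r - k))
    (hγ : ContMDiffOn 𝓘(ℝ, ℝ) (model n) ∞ γ (Icc u v)) :
    ContMDiffOn 𝓘(ℝ, ℝ) (model n) ∞ γ' (Icc (u + k) (v + k)) := by
  have h1 : ContMDiffOn 𝓘(ℝ, ℝ) 𝓘(ℝ, ℝ) ∞ (fun r : ℝ => r - k) (Icc (u + k) (v + k)) :=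
    (contDiff_id.sub contDiff_const).contMDiff.contMDiffOn
  exact (hγ.comp h1 fun r hr => ⟨by linarith [hr.1], by linarith [hr.2]⟩).congr h

theorem smooth_piece_of_translate (G : GRWSpacetime n S)
    (h : ∀ r ∈ Icc (u + k) (v + k), γ' r = γ (r - k))
    (hγ : ContMDiffOn 𝓘(ℝ, ℝ) (model n) ∞ γ (Icc u v) ∧ MapsTo γ (Icc u v) G.carrier) :
    ContMDiffOn 𝓘(ℝ, ℝ) (model n) ∞ γ' (Icc (u + k) (v + k)) ∧
      MapsTo γ' (Icc (u + k) (v + k)) G.carrier := by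
  refine ⟨contMDiffOn_of_translate h hγ.1, fun r hr => ?_⟩
  rw [h r hr]
  exact hγ.2 ⟨by linarith [hr.1], by linarith [hr.2]⟩

end Translation

theorem isTranslationInvariant_elevator (G : GRWSpacetime n S) (τ : ℝ × S → ℝ) :
    IsTranslationInvariant G.IsElevatorPiece (G.riemannianizedCost τ) := by
  intro γ γ' u v k huv h hP
  have hmem : ∀ r ∈ Icc (u + k) (v + k), r - k ∈ Icc u v := fun r hr =>
    ⟨by linarith [hr.1], by linarith [hr.2]⟩
  have hu : γ' (u + k) = γ u := by
    rw [h _ ⟨le_rfl, by linarith⟩, add_sub_cancel_right]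
  refine ⟨⟨G.smooth_piece_of_translate h hP.1, ?_⟩, ?_⟩
  · rw [hu]
    refine hP.2.imp (fun h2 r hr => ?_) (fun h2 r hr => ?_) <;> rw [h r hr] <;> exact h2 _ (hmem r hr)
  · unfold riemannianizedCost
    have hmd : MDifferentiableOn 𝓘(ℝ, ℝ) (model n) γ (Icc u v) := hP.1.1.mdifferentiableOn (by simp)
    rw [setLIntegral_congr_fun measurableSet_Icc fun t ht => apply_velocity_of_translate
      (fun p w => ENNReal.ofReal (√(riemannianize (model n) G.metric τ p w w))) h huv hmd ht]
    have himg : Icc (u + k) (v + k) = (fun r : ℝ => r - k) ⁻¹' Icc u v := by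
      ext r
      simp
    rw [himg]
    exact (measurePreserving_sub_right volume k).setLIntegral_comp_preimage_emb
      (Homeomorph.subRight k).measurableEmbedding (fun t => ENNReal.ofReal
        (√(riemannianize (model n) G.metric τ (γ t) (velocity (model n) γ u v t)
          (velocity (model n) γ u v t)))) _

theorem isTranslationInvariant_null (G : GRWSpacetime n S) (τ : ℝ × S → ℝ) :
    IsTranslationInvariant G.IsCausalPiece (fun γ u v => ENNReal.ofReal |τ (γ v) - τ (γ u)|) := by
  intro γ γ' u v k huv h hP
  have hmem : ∀ r ∈ Icc (u + k) (v + k), r - k ∈ Icc u v := fun r hr =>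
    ⟨by linarith [hr.1], by linarith [hr.2]⟩
  have hu : γ' (u + k) = γ u := by
    rw [h _ ⟨le_rfl, by linarith⟩, add_sub_cancel_right]
  have hv : γ' (v + k) = γ v := by
    rw [h _ ⟨by linarith, le_rfl⟩, add_sub_cancel_right]
  have hmd : MDifferentiableOn 𝓘(ℝ, ℝ) (model n) γ (Icc u v) := hP.1.1.mdifferentiableOn (by simp)
  refine ⟨⟨G.smooth_piece_of_translate h hP.1, ?_⟩, by simp only [hu, hv]⟩
  refine hP.2.imp (fun h2 t ht => ?_) (Or.imp (fun h2 t ht => ?_) fun h2 t ht => ?_)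
  · rw [apply_velocity_of_translate (IsFutureCausal (model n) G.metric (timeField n S)) h huv hmd ht]
    exact h2 _ (hmem t ht)
  · rw [apply_velocity_of_translate (IsPastCausal (model n) G.metric (timeField n S)) h huv hmd ht]
    exact h2 _ (hmem t ht)
  · rw [hu, h t ht]
    exact h2 _ (hmem t ht)

theorem elevatorDist_triangle (G : GRWSpacetime n S) (τ : ℝ × S → ℝ) (p q r : ℝ × S) :
    G.elevatorDist τ p r ≤ G.elevatorDist τ p q + G.elevatorDist τ q r := by
  rw [elevatorDist_eq_chainDist]
  exact chainDist_triangle (G.isTranslationInvariant_elevator τ) p q r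

theorem nullDistance_triangle (G : GRWSpacetime n S) (τ : ℝ × S → ℝ) (p q r : ℝ × S) :
    G.nullDistance τ p r ≤ G.nullDistance τ p q + G.nullDistance τ q r := by
  rw [nullDistance_eq_chainDist]
  exact chainDist_triangle (G.isTranslationInvariant_null τ) p q r

/-! ### Curves with affine time component -/

section Affine

variable {σ : ℝ → S} {x y t₀ k : ℝ}

omit [IsManifold (𝓡 n) ∞ S] in
theorem contMDiffOn_affine (hσ : ContMDiffOn 𝓘(ℝ, ℝ) (𝓡 n) ∞ σ (Icc x y)) :
    ContMDiffOn 𝓘(ℝ, ℝ) (model n) ∞ (fun r => (t₀ + k * (r - x), σ r)) (Icc x y) := by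
  have h1 : ContDiff ℝ ∞ fun r : ℝ => t₀ + k * (r - x) := by fun_prop
  exact h1.contMDiff.contMDiffOn.prodMk hσ

theorem derivWithin_affine (hxy : x < y) {r : ℝ} (hr : r ∈ Icc x y) :
    derivWithin (fun r : ℝ => t₀ + k * (r - x)) (Icc x y) r = k := by
  have h : HasDerivAt (fun r : ℝ => t₀ + k * (r - x)) k r := by
    simpa using (((hasDerivAt_id r).sub_const x).const_mul k).const_add t₀
  exact h.hasDerivWithinAt.derivWithin (uniqueDiffOn_Icc hxy r hr)

/-- The cost of an affine curve for the Riemannianized metric. -/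
theorem riemannianizedCost_affine (G : GRWSpacetime n S) {φ : ℝ → ℝ} {τ : ℝ × S → ℝ}
    (hτ : ∀ p ∈ G.carrier, τ p = φ p.1) (hφ : ∀ r ∈ G.interval, 0 < deriv φ r)
    (hxy : x < y) (hσ : ContMDiffOn 𝓘(ℝ, ℝ) (𝓡 n) ∞ σ (Icc x y))
    (hmem : ∀ r ∈ Icc x y, t₀ + k * (r - x) ∈ G.interval) :
    G.riemannianizedCost τ (fun r => (t₀ + k * (r - x), σ r)) x y =
      ∫⁻ r in Icc x y, ENNReal.ofReal
        (√(k ^ 2 + (G.f (t₀ + k * (r - x)) * G.speed σ x y r) ^ 2)) := by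
  unfold riemannianizedCost
  refine setLIntegral_congr_fun measurableSet_Icc fun r hr => ?_
  have := G.riemannianize_velocity hτ hφ (contMDiffOn_affine (t₀ := t₀) (k := k) hσ) hxy hr
    (hmem r hr)
  simp only at this ⊢
  rw [this, derivWithin_affine hxy hr]

/-- A time component of constant slope `k` makes the whole curve a single causal piece as soon as `f
|σ'| ≤ |k|`, and only its end times enter the null length. -/
theorem nullDistance_affine_le (G : GRWSpacetime n S) {φ : ℝ → ℝ} {τ : ℝ × S → ℝ}
    (hτ : ∀ p ∈ G.carrier, τ p = φ p.1) (hxy : x < y) (hk : k ≠ 0)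
    (hσ : ContMDiffOn 𝓘(ℝ, ℝ) (𝓡 n) ∞ σ (Icc x y))
    (hmem : ∀ r ∈ Icc x y, t₀ + k * (r - x) ∈ G.interval)
    (hcausal : ∀ r ∈ Icc x y, G.f (t₀ + k * (r - x)) * G.speed σ x y r ≤ |k|) :
    G.nullDistance τ (t₀, σ x) (t₀ + k * (y - x), σ y) ≤
      ENNReal.ofReal |φ (t₀ + k * (y - x)) - φ t₀| := by
  set γ : ℝ → ℝ × S := fun r => (t₀ + k * (r - x), σ r) with hγ
  have hsm : ContMDiffOn 𝓘(ℝ, ℝ) (model n) ∞ γ (Icc x y) := contMDiffOn_affine hσ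
  have hmaps : MapsTo γ (Icc x y) G.carrier := fun r hr => hmem r hr
  have hle : ∀ r ∈ Icc x y, G.metric (γ r) (velocity (model n) γ x y r)
      (velocity (model n) γ x y r) ≤ 0 := by
    intro r hr
    rw [G.metric_velocity hsm hxy hr]
    simp only [hγ]
    rw [derivWithin_affine hxy hr, ← sq_abs k]
    have h0 : 0 ≤ G.f (t₀ + k * (r - x)) * G.speed σ x y r :=
      mul_nonneg (G.f_pos _ (hmem r hr).1 (hmem r hr).2).le (G.speed_nonneg _ _ _ _)
    exact sub_nonpos.2 (pow_le_pow_left₀ h0 (hcausal r hr) 2)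
  have htime : ∀ r ∈ Icc x y, G.metric (γ r) (timeField n S (γ r))
      (velocity (model n) γ x y r) = -k := by
    intro r hr
    rw [G.metric_timeField_velocity hsm hxy hr]
    simp only [hγ]
    rw [derivWithin_affine hxy hr]
  have hP : G.IsCausalPiece γ x y := by
    refine ⟨⟨hsm, hmaps⟩, ?_⟩
    -- Since `g(∂_t, γ') = -k`, the sign of `k` decides between past and future.
    rcases hk.lt_or_gt with h | h
    · exact Or.inr (Or.inl fun r hr => ⟨hle r hr, by rw [htime r hr]; linarith⟩)
    · exact Or.inl fun r hr => ⟨hle r hr, by rw [htime r hr]; linarith⟩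
  have hmain := chainDist_le_of_piece (c := fun γ u v => ENNReal.ofReal |τ (γ v) - τ (γ u)|) hxy hP
  rw [← nullDistance_eq_chainDist, hτ _ (hmaps ⟨le_rfl, hxy.le⟩), hτ _ (hmaps ⟨hxy.le, le_rfl⟩)]
    at hmain
  simpa [hγ] using hmain

end Affine

/-! ### Upper bounds -/

section Upper

variable {φ : ℝ → ℝ} {τ : ℝ × S → ℝ}

theorem segment_mem_interval (G : GRWSpacetime n S) {t₀ t₁ : ℝ} (h₀ : t₀ ∈ G.interval)
    (h₁ : t₁ ∈ G.interval) : ∀ r ∈ Icc (0 : ℝ) 1, t₀ + (t₁ - t₀) * (r - 0) ∈ G.interval := by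
  intro r hr
  have := G.ordConnected_interval.convex.add_smul_sub_mem h₀ h₁ hr
  simpa [mul_comm] using this

theorem elevatorDist_vertical_le (G : GRWSpacetime n S)
    (hτ : ∀ p ∈ G.carrier, τ p = φ p.1) (hφ : ∀ r ∈ G.interval, 0 < deriv φ r) {t₀ t₁ : ℝ}
    (h₀ : t₀ ∈ G.interval) (h₁ : t₁ ∈ G.interval) (z : S) :
    G.elevatorDist τ (t₀, z) (t₁, z) ≤ ENNReal.ofReal |t₁ - t₀| := by
  have hσ : ContMDiffOn 𝓘(ℝ, ℝ) (𝓡 n) ∞ (fun _ : ℝ => z) (Icc 0 1) := contMDiffOn_const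
  have hP : G.IsElevatorPiece (fun r => (t₀ + (t₁ - t₀) * (r - 0), z)) 0 1 :=
    ⟨⟨contMDiffOn_affine hσ, G.segment_mem_interval h₀ h₁⟩, Or.inl fun _ _ => rfl⟩
  have h := chainDist_le_of_piece (c := G.riemannianizedCost τ) one_pos hP
  rw [← elevatorDist_eq_chainDist, G.riemannianizedCost_affine hτ hφ one_pos hσ
    (G.segment_mem_interval h₀ h₁)] at h
  simpa [speed_const, Real.sqrt_sq_eq_abs] using h

theorem elevatorDist_horizontal_le (G : GRWSpacetime n S)
    (hτ : ∀ p ∈ G.carrier, τ p = φ p.1) (hφ : ∀ r ∈ G.interval, 0 < deriv φ r) {t₀ : ℝ}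
    (h₀ : t₀ ∈ G.interval) {σ : ℝ → S} {u v : ℝ} (huv : u < v)
    (hσ : ContMDiffOn 𝓘(ℝ, ℝ) (𝓡 n) ∞ σ (Icc u v)) :
    G.elevatorDist τ (t₀, σ u) (t₀, σ v) ≤
      ENNReal.ofReal (G.f t₀) * ∫⁻ t in Icc u v, ENNReal.ofReal (G.speed σ u v t) := by
  -- Slope zero presents the slice curve as an affine one, whose cost is already computed.
  have hmem : ∀ r ∈ Icc u v, t₀ + 0 * (r - u) ∈ G.interval := fun r _ => by simpa using h₀
  have hP : G.IsElevatorPiece (fun r => (t₀ + 0 * (r - u), σ r)) u v :=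
    ⟨⟨contMDiffOn_affine hσ, hmem⟩, Or.inr fun _ _ => by simp⟩
  have h := chainDist_le_of_piece (c := G.riemannianizedCost τ) huv hP
  have hf := G.f_pos t₀ h₀.1 h₀.2
  rw [← elevatorDist_eq_chainDist, G.riemannianizedCost_affine hτ hφ huv hσ hmem] at h
  simp only [zero_mul, add_zero] at h
  refine h.trans_eq ?_
  rw [← lintegral_const_mul' _ _ ENNReal.ofReal_ne_top]
  refine lintegral_congr fun r => ?_
  rw [← ENNReal.ofReal_mul hf.le]
  norm_num
  rw [Real.sqrt_sq (mul_nonneg hf.le (G.speed_nonneg _ _ _ _))]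

theorem nullDistance_vertical_le (G : GRWSpacetime n S)
    (hτ : ∀ p ∈ G.carrier, τ p = φ p.1) {t₀ t₁ : ℝ}
    (h₀ : t₀ ∈ G.interval) (h₁ : t₁ ∈ G.interval) (z : S) :
    G.nullDistance τ (t₀, z) (t₁, z) ≤ ENNReal.ofReal |φ t₁ - φ t₀| := by
  have hσ : ContMDiffOn 𝓘(ℝ, ℝ) (𝓡 n) ∞ (fun _ : ℝ => z) (Icc 0 1) := contMDiffOn_const
  -- Equal times would give slope zero, which is not causal; a constant piece is used instead.
  rcases eq_or_ne t₁ t₀ with rfl | hne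
  · have hP : G.IsCausalPiece (fun _ => (t₁, z)) 0 1 :=
      ⟨⟨contMDiffOn_const, fun _ _ => h₀⟩, Or.inr (Or.inr fun _ _ => rfl)⟩
    have h := chainDist_le_of_piece (c := fun γ u v => ENNReal.ofReal |τ (γ v) - τ (γ u)|)
      one_pos hP
    rw [← nullDistance_eq_chainDist] at h
    simpa using h
  · have := G.nullDistance_affine_le hτ one_pos (sub_ne_zero.2 hne) hσ
      (G.segment_mem_interval h₀ h₁) (fun r _ => by rw [speed_const]; simp)
    simpa using this

theorem abs_sub_le_of_deriv_le (G : GRWSpacetime n S) {D : ℝ}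
    (hφ : ∀ r ∈ G.interval, 0 < deriv φ r) (hD : ∀ r ∈ G.interval, deriv φ r ≤ D) {t₀ t₁ : ℝ}
    (h₀ : t₀ ∈ G.interval) (h₁ : t₁ ∈ G.interval) : |φ t₁ - φ t₀| ≤ D * |t₁ - t₀| :=
  G.ordConnected_interval.convex.norm_image_sub_le_of_norm_deriv_le
    (fun r hr => differentiableAt_of_deriv_ne_zero (hφ r hr).ne')
    (fun r hr => by rw [Real.norm_of_nonneg (hφ r hr).le]; exact hD r hr) h₀ h₁

/-- A zigzag of two causal pieces over a short curve in `S`. -/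
theorem nullDistance_zigzag_le (G : GRWSpacetime n S) {D : ℝ}
    (hτ : ∀ p ∈ G.carrier, τ p = φ p.1) (hφ : ∀ r ∈ G.interval, 0 < deriv φ r)
    (hD : ∀ r ∈ G.interval, deriv φ r ≤ D) {t₀ K : ℝ} (hK : 0 < K) {σ : ℝ → S} {x y : ℝ}
    (hxy : x < y) (hσ : ContMDiffOn 𝓘(ℝ, ℝ) (𝓡 n) ∞ σ (Icc x y))
    (hmem : ∀ t ∈ Icc t₀ (t₀ + K * (y - x)), t ∈ G.interval)
    (hcausal : ∀ t ∈ Icc t₀ (t₀ + K * (y - x)), ∀ r ∈ Icc x y, G.f t * G.speed σ x y r ≤ K) :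
    G.nullDistance τ (t₀, σ x) (t₀, σ y) ≤ ENNReal.ofReal (D * K * (y - x)) := by
  -- Time rises with slope `K` up to the midpoint and falls with slope `-K` afterwards, thus
  -- returning to `t₀`.
  set m := (x + y) / 2 with hm
  have hxm : x < m := by linarith
  have hmy : m < y := by linarith
  have hsub₁ : Icc x m ⊆ Icc x y := Icc_subset_Icc_right hmy.le
  have hsub₂ : Icc m y ⊆ Icc x y := Icc_subset_Icc_left hxm.le
  have htop : t₀ + K * (m - x) ∈ G.interval :=
    hmem _ ⟨by nlinarith, by nlinarith⟩
  have hbot : t₀ ∈ G.interval := hmem _ ⟨le_rfl, by nlinarith⟩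
  have hin₁ : ∀ r ∈ Icc x m, t₀ + K * (r - x) ∈ Icc t₀ (t₀ + K * (y - x)) := fun r hr =>
    ⟨by nlinarith [hr.1], by nlinarith [hr.2]⟩
  have hin₂ : ∀ r ∈ Icc m y, t₀ + K * (m - x) + -K * (r - m) ∈ Icc t₀ (t₀ + K * (y - x)) :=
    fun r hr => ⟨by nlinarith [hr.2], by nlinarith [hr.1]⟩
  have h1 := G.nullDistance_affine_le hτ hxm hK.ne' (hσ.mono hsub₁) (t₀ := t₀)
    (fun r hr => hmem _ (hin₁ r hr)) (fun r hr => by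
      rw [G.speed_of_subset hσ hxm hsub₁ hr, abs_of_pos hK]
      exact hcausal _ (hin₁ r hr) r (hsub₁ hr))
  have h2 := G.nullDistance_affine_le hτ hmy (neg_ne_zero.2 hK.ne') (hσ.mono hsub₂)
    (t₀ := t₀ + K * (m - x))
    (fun r hr => hmem _ (hin₂ r hr)) (fun r hr => by
      rw [G.speed_of_subset hσ hmy hsub₂ hr, abs_neg, abs_of_pos hK]
      exact hcausal _ (hin₂ r hr) r (hsub₂ hr))
  have hend : t₀ + K * (m - x) + -K * (y - m) = t₀ := by rw [hm]; ring
  rw [hend] at h2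
  have hD0 : 0 ≤ D := (hφ _ hbot).le.trans (hD _ hbot)
  refine (G.nullDistance_triangle τ _ (t₀ + K * (m - x), σ m) _).trans ((add_le_add h1 h2).trans ?_)
  rw [← ENNReal.ofReal_add (abs_nonneg _) (abs_nonneg _)]
  refine ENNReal.ofReal_le_ofReal ?_
  have e1 := G.abs_sub_le_of_deriv_le hφ hD hbot htop
  rw [abs_sub_comm (φ t₀)]
  rw [add_sub_cancel_left, abs_of_pos (mul_pos hK (sub_pos.2 hxm))] at e1
  have : D * K * (y - x) = D * (K * (m - x)) + D * (K * (m - x)) := by rw [hm]; ring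
  linarith

end Upper

end GRWSpacetime

namespace GRWSpacetime

variable {n : ℕ} {S : Type*} [TopologicalSpace S]
  [ChartedSpace (EuclideanSpace ℝ (Fin n)) S] [IsManifold (𝓡 n) ∞ S]

/-! ### Null distance along curves in a time slice -/

section Upper

variable {φ : ℝ → ℝ} {τ : ℝ × S → ℝ}

/-- Near each parameter `f` and the speed are almost constant, so a low zigzag whose slope `K`
slightly exceeds their product is causal, and `K` exceeds the integrand `f(t₀) |σ'|` by at most `ε`.
-/
theorem nullDistance_horizontal_le_lintegral (G : GRWSpacetime n S) {D : ℝ}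
    (hτ : ∀ p ∈ G.carrier, τ p = φ p.1) (hφ : ∀ r ∈ G.interval, 0 < deriv φ r)
    (hD : ∀ r ∈ G.interval, deriv φ r ≤ D) {t₀ : ℝ} (h₀ : t₀ ∈ G.interval) {σ : ℝ → S} {u v : ℝ}
    (huv : u < v) (hσ : ContMDiffOn 𝓘(ℝ, ℝ) (𝓡 n) ∞ σ (Icc u v)) {ε : ℝ} (hε : 0 < ε) :
    G.nullDistance τ (t₀, σ u) (t₀, σ v) ≤
      ∫⁻ t in Ioc u v, ENNReal.ofReal (D * (G.f t₀ * G.speed σ u v t + ε)) := by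
  have hD0 : 0 ≤ D := (hφ _ h₀).le.trans (hD _ h₀)
  have hf0 := G.f_pos t₀ h₀.1 h₀.2
  refine le_lintegral_of_locally (G.nullDistance_triangle τ) (x := fun r => (t₀, σ r)) huv
    fun z hz => ?_
  set w := G.speed σ u v with hw
  have hwz : 0 ≤ w z := G.speed_nonneg _ _ _ _
  -- The difference to be absorbed is `η (2 f(t₀) + w z + η)`, and `η ≤ 1` bounds the bracket by `2
  -- f(t₀) + w z + 1`.
  obtain ⟨η, hη, hηε⟩ : ∃ η > 0, (G.f t₀ + η) * (w z + η) ≤ G.f t₀ * (w z - η) + ε := by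
    have hpos : 0 < 2 * G.f t₀ + w z + 1 := by linarith
    refine ⟨min 1 (ε / (2 * G.f t₀ + w z + 1)), lt_min one_pos (div_pos hε hpos), ?_⟩
    set η := min 1 (ε / (2 * G.f t₀ + w z + 1))
    have h0 : 0 < η := lt_min one_pos (div_pos hε hpos)
    have h1 : η ≤ 1 := min_le_left _ _
    have h2 : η * (2 * G.f t₀ + w z + 1) ≤ ε := (le_div_iff₀ hpos).1 (min_le_right _ _)
    nlinarith
  obtain ⟨δ, hδ, hδw⟩ := Metric.continuousOn_iff.1 (G.continuousOn_speed huv hσ) z hz η hη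
  obtain ⟨ρ, hρ, hρf⟩ : ∃ ρ > 0, ∀ t, |t - t₀| < ρ → t ∈ G.interval ∧ G.f t < G.f t₀ + η := by
    have hc : ContinuousAt G.f t₀ :=
      G.f_smooth.continuousOn.continuousAt (G.isOpen_interval.mem_nhds h₀)
    have hI : ∀ᶠ t in nhds t₀, t ∈ G.interval := G.isOpen_interval.mem_nhds h₀
    have hev := hI.and (hc.eventually_lt (continuousAt_const (y := G.f t₀ + η)) (by linarith))
    exact Metric.eventually_nhds_iff.1 hev
  set K := (G.f t₀ + η) * (w z + η) with hKdef
  have hK : 0 < K := by positivity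
  -- Then `s - r < ρ / K`, so the zigzag rises by less than `ρ` and stays where `f < f(t₀) + η`.
  refine ⟨min δ (ρ / (2 * K)), lt_min hδ (by positivity), fun r s hr hs hrz hsz hrs => ?_⟩
  have hsub : Icc r s ⊆ Icc u v := Icc_subset_Icc hr.1 hs.2
  have hnear : ∀ a ∈ Icc r s, |w a - w z| < η := by
    intro a ha
    refine hδw a (hsub ha) ?_
    rw [Real.dist_eq]
    have h1 := (abs_lt.1 (hrz.trans_le (min_le_left _ _))).1
    have h2 := (abs_lt.1 (hsz.trans_le (min_le_left _ _))).2
    exact abs_lt.2 ⟨by linarith [ha.1], by linarith [ha.2]⟩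
  have hlen : K * (s - r) < ρ := by
    have h1 := (abs_lt.1 (hrz.trans_le (min_le_right _ _))).1
    have h2 := (abs_lt.1 (hsz.trans_le (min_le_right _ _))).2
    have h3 : s - r < 2 * (ρ / (2 * K)) := by linarith
    calc K * (s - r) < K * (2 * (ρ / (2 * K))) := by gcongr
      _ = ρ := by field_simp
  have htime : ∀ t ∈ Icc t₀ (t₀ + K * (s - r)), t ∈ G.interval ∧ G.f t < G.f t₀ + η := fun t ht =>
    hρf t (abs_lt.2 ⟨by linarith [ht.1], by linarith [ht.2]⟩)
  refine (G.nullDistance_zigzag_le hτ hφ hD hK hrs (hσ.mono hsub) (fun t ht => (htime t ht).1)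
    fun t ht a ha => ?_).trans ?_
  · rw [G.speed_of_subset hσ hrs hsub ha]
    have h1 := (abs_lt.1 (hnear a ha)).2
    exact mul_le_mul (htime t ht).2.le (by linarith) (G.speed_nonneg _ _ _ _) (by linarith)
  · have hconst : ENNReal.ofReal (D * K * (s - r)) = ∫⁻ _ in Ioc r s, ENNReal.ofReal (D * K) := by
      rw [setLIntegral_const, Real.volume_Ioc, ENNReal.ofReal_mul (mul_nonneg hD0 hK.le)]
    rw [hconst]
    refine setLIntegral_mono' measurableSet_Ioc fun a ha => ENNReal.ofReal_le_ofReal ?_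
    have h1 := (abs_lt.1 (hnear a (Ioc_subset_Icc_self ha))).1
    refine mul_le_mul_of_nonneg_left (hηε.trans ?_) hD0
    have : G.f t₀ * (w z - η) ≤ G.f t₀ * w a := mul_le_mul_of_nonneg_left (by linarith) hf0.le
    linarith

theorem nullDistance_horizontal_le (G : GRWSpacetime n S) {D : ℝ}
    (hτ : ∀ p ∈ G.carrier, τ p = φ p.1) (hφ : ∀ r ∈ G.interval, 0 < deriv φ r)
    (hD : ∀ r ∈ G.interval, deriv φ r ≤ D) {t₀ : ℝ} (h₀ : t₀ ∈ G.interval) {σ : ℝ → S} {u v : ℝ}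
    (huv : u < v) (hσ : ContMDiffOn 𝓘(ℝ, ℝ) (𝓡 n) ∞ σ (Icc u v)) :
    G.nullDistance τ (t₀, σ u) (t₀, σ v) ≤ ENNReal.ofReal D * ENNReal.ofReal (G.f t₀) *
      ∫⁻ t in Icc u v, ENNReal.ofReal (G.speed σ u v t) := by
  have hD0 : 0 < D := (hφ _ h₀).trans_le (hD _ h₀)
  have hf0 := G.f_pos t₀ h₀.1 h₀.2
  refine ENNReal.le_of_forall_pos_le_add fun ε hε _ => ?_
  -- With this error the factor `D` and the integration over `[u, v]` leave exactly `ε`.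
  have hε' : 0 < (ε : ℝ) / (D * (v - u)) := div_pos hε (mul_pos hD0 (sub_pos.2 huv))
  refine (G.nullDistance_horizontal_le_lintegral hτ hφ hD h₀ huv hσ hε').trans ?_
  have hpt : ∀ t, ENNReal.ofReal (D * (G.f t₀ * G.speed σ u v t + ε / (D * (v - u)))) =
      ENNReal.ofReal D * ENNReal.ofReal (G.f t₀) * ENNReal.ofReal (G.speed σ u v t) +
        ENNReal.ofReal (ε / (v - u)) := by
    intro t
    have hw := G.speed_nonneg σ u v t
    rw [← ENNReal.ofReal_mul hD0.le, ← ENNReal.ofReal_mul (by positivity),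
      ← ENNReal.ofReal_add (by positivity) (div_nonneg ε.coe_nonneg (sub_pos.2 huv).le)]
    congr 1
    have := (sub_pos.2 huv).ne'
    field_simp
  simp only [hpt]
  rw [lintegral_add_right _ measurable_const, lintegral_const_mul' _ _
    (ENNReal.mul_ne_top ENNReal.ofReal_ne_top ENNReal.ofReal_ne_top), setLIntegral_const,
    Real.volume_Ioc, ← ENNReal.ofReal_mul (div_nonneg ε.coe_nonneg (sub_pos.2 huv).le),
    div_mul_cancel₀ _ (sub_pos.2 huv).ne', ENNReal.ofReal_coe_nnreal]
  gcongr
  exact Ioc_subset_Icc_self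

end Upper

/-! ### The properties (F2)-(F4) -/

/-- A competitor for `d_S` is lifted piece by piece to the slice `t = t₀`, and the triangle
inequality sums the pieces. -/
theorem F3_of_horizontal_le (G : GRWSpacetime n S) {d : ℝ × S → ℝ × S → ℝ≥0∞} {D : ℝ} (hD : 0 < D)
    (htri : ∀ p q r, d p r ≤ d p q + d q r)
    (h : ∀ t₀ ∈ G.interval, ∀ (σ : ℝ → S) (u v : ℝ), u < v →
      ContMDiffOn 𝓘(ℝ, ℝ) (𝓡 n) ∞ σ (Icc u v) → d (t₀, σ u) (t₀, σ v) ≤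
        ENNReal.ofReal D * ENNReal.ofReal (G.f t₀) *
          ∫⁻ t in Icc u v, ENNReal.ofReal (G.speed σ u v t)) : G.F3 d D := by
  refine ⟨hD, ?_⟩
  rintro ⟨t₀, x⟩ hp ⟨t₁, y⟩ - (rfl : t₀ = t₁)
  have hf0 : 0 < G.f t₀ := G.f_pos t₀ hp.1 hp.2
  have hne : ENNReal.ofReal D * ENNReal.ofReal (G.f t₀) ≠ 0 :=
    mul_ne_zero (by simpa using hD) (by simpa using hf0)
  have htop : ENNReal.ofReal D * ENNReal.ofReal (G.f t₀) ≠ ⊤ :=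
    ENNReal.mul_ne_top ENNReal.ofReal_ne_top ENNReal.ofReal_ne_top
  -- The finite nonzero factor is moved to the other side so that `d_S` stands alone and can be
  -- treated as an infimum.
  rw [mul_comm _ (G.spaceDist _ _), ← ENNReal.div_le_iff hne htop]
  refine le_iInf fun σ => le_iInf fun m => le_iInf fun s => le_iInf fun hs => le_iInf fun hx =>
    le_iInf fun hy => ?_
  rw [ENNReal.div_le_iff hne htop, mul_comm]
  unfold arcLength
  simp only at hx hy
  rw [Finset.mul_sum, ← hx, ← hy]
  exact le_sum_range_of_triangle htri (fun i => (t₀, σ (s i))) _ hs.1 fun i hi =>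
    h t₀ hp σ _ _ (hs.2 i hi).1 (hs.2 i hi).2.1

/-- The route is `p → (c, p_S) → (c, q_S) → q`: vertical, horizontal, vertical. -/
theorem F4_of_F2_of_F3 (G : GRWSpacetime n S) {d : ℝ × S → ℝ × S → ℝ≥0∞} {D : ℝ}
    (htri : ∀ p q r, d p r ≤ d p q + d q r) (h2 : G.F2 d D) (h3 : G.F3 d D) : G.F4 d D := by
  refine ⟨h2.1, fun p hp q hq c hc => ?_⟩
  have e1 := h2.2 p hp (c, p.2) hc rfl
  have e2 := h3.2 (c, p.2) hc (c, q.2) hc rfl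
  have e3 := h2.2 (c, q.2) hc q hq rfl
  refine (htri p (c, p.2) q).trans ((add_le_add e1 ((htri _ (c, q.2) q).trans
    (add_le_add e2 e3))).trans_eq ?_)
  rw [ENNReal.ofReal_mul h2.1.le, ENNReal.ofReal_mul h2.1.le, abs_sub_comm c]
  ring

end GRWSpacetime

/-! ### Variation of real functions and the integral of the derivative -/

section Variation

variable {h : ℝ → ℝ} {u v : ℝ}

theorem lintegral_abs_derivWithin_Icc_eq (h : ℝ → ℝ) (u v : ℝ) :
    ∫⁻ t in Icc u v, ENNReal.ofReal |derivWithin h (Icc u v) t| =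
      ∫⁻ t in Ioc u v, ‖deriv h t‖ₑ := by
  rw [← restrict_Ioo_eq_restrict_Icc, ← restrict_Ioo_eq_restrict_Ioc]
  refine setLIntegral_congr_fun measurableSet_Ioo fun t ht => ?_
  rw [derivWithin_of_mem_nhds (Icc_mem_nhds ht.1 ht.2), ← Real.enorm_eq_ofReal_abs]

/-- The variation of a `C¹` function through an intermediate point is at most `∫ |h'|`. -/
theorem ofReal_abs_sub_add_abs_sub_le_lintegral (hh : ContDiffOn ℝ 1 h (Icc u v)) {r : ℝ}
    (hr : r ∈ Icc u v) : ENNReal.ofReal (|h r - h u| + |h v - h r|) ≤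
      ∫⁻ t in Icc u v, ENNReal.ofReal |derivWithin h (Icc u v) t| := by
  rw [lintegral_abs_derivWithin_Icc_eq, ← Ioc_union_Ioc_eq_Ioc hr.1 hr.2,
    lintegral_union measurableSet_Ioc (Ioc_disjoint_Ioc_of_le le_rfl),
    ENNReal.ofReal_add (abs_nonneg _) (abs_nonneg _), ← Real.enorm_eq_ofReal_abs,
    ← Real.enorm_eq_ofReal_abs, restrict_Ioc_eq_restrict_Icc, restrict_Ioc_eq_restrict_Icc]
  exact add_le_add
    (enorm_sub_le_lintegral_deriv_of_contDiffOn_Icc (hh.mono (Icc_subset_Icc_right hr.2)) hr.1)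
    (enorm_sub_le_lintegral_deriv_of_contDiffOn_Icc (hh.mono (Icc_subset_Icc_left hr.1)) hr.2)

theorem lintegral_derivWithin_of_nonneg (hh : ContDiffOn ℝ 1 h (Icc u v)) (huv : u < v)
    (h0 : ∀ t ∈ Icc u v, 0 ≤ derivWithin h (Icc u v) t) :
    ∫⁻ t in Icc u v, ENNReal.ofReal |derivWithin h (Icc u v) t| = ENNReal.ofReal |h v - h u| := by
  have hc : ContinuousOn (derivWithin h (Icc u v)) (Icc u v) :=
    hh.continuousOn_derivWithin (uniqueDiffOn_Icc huv) le_rfl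
  have hint := intervalIntegral.integral_derivWithin_Icc_of_contDiffOn_Icc hh huv.le
  rw [intervalIntegral.integral_of_le huv.le, ← integral_Icc_eq_integral_Ioc] at hint
  have hae : 0 ≤ᵐ[volume.restrict (Icc u v)] derivWithin h (Icc u v) :=
    (ae_restrict_iff' measurableSet_Icc).2 (Filter.Eventually.of_forall h0)
  rw [setLIntegral_congr_fun measurableSet_Icc fun t ht => by rw [abs_of_nonneg (h0 t ht)],
    ← ofReal_integral_eq_lintegral_ofReal hc.integrableOn_Icc hae, hint, abs_of_nonneg]
  rw [← hint]
  exact integral_nonneg_of_ae hae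

theorem lintegral_derivWithin_of_nonpos (hh : ContDiffOn ℝ 1 h (Icc u v)) (huv : u < v)
    (h0 : ∀ t ∈ Icc u v, derivWithin h (Icc u v) t ≤ 0) :
    ∫⁻ t in Icc u v, ENNReal.ofReal |derivWithin h (Icc u v) t| = ENNReal.ofReal |h v - h u| := by
  have := lintegral_derivWithin_of_nonneg hh.neg huv (fun t ht => by
    rw [derivWithin.fun_neg]; linarith [h0 t ht])
  simp only [derivWithin.fun_neg, abs_neg] at this
  rw [this, neg_sub_neg, abs_sub_comm]

/-- A sum of costs bounding the variation of `h` on each piece bounds the variation of `h` through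
any intermediate point. -/
theorem ofReal_variation_le_sum {h : ℝ → ℝ} {s : ℕ → ℝ} {C : ℝ} (hC : 0 ≤ C) {cost : ℕ → ℝ≥0∞}
    {m : ℕ} (hs : ∀ i < m, s i ≤ s (i + 1))
    (hcost : ∀ i < m, ∀ r ∈ Icc (s i) (s (i + 1)),
      ENNReal.ofReal (C * (|h r - h (s i)| + |h (s (i + 1)) - h r|)) ≤ cost i) :
    ENNReal.ofReal (C * |h (s m) - h (s 0)|) ≤ ∑ i ∈ Finset.range m, cost i ∧
      ∀ j < m, ∀ r ∈ Icc (s j) (s (j + 1)),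
        ENNReal.ofReal (C * (|h r - h (s 0)| + |h (s m) - h r|)) ≤
          ∑ i ∈ Finset.range m, cost i := by
  induction m with
  | zero => simp
  | succ m ih =>
    obtain ⟨iha, ihb⟩ := ih (fun i hi => hs i (by omega)) (fun i hi => hcost i (by omega))
    have hlast := hcost m (by omega)
    -- At the left endpoint `r = s m` the bound on the last piece reduces to the plain increment of
    -- `h`.
    have hstep := hlast (s m) ⟨le_rfl, hs m (by omega)⟩
    simp only [sub_self, abs_zero, zero_add] at hstep
    rw [Finset.sum_range_succ]
    refine ⟨?_, fun j hj r hr => ?_⟩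
    · refine le_trans ?_ (add_le_add iha hstep)
      rw [← ENNReal.ofReal_add (by positivity) (by positivity), ← mul_add]
      exact ENNReal.ofReal_le_ofReal (mul_le_mul_of_nonneg_left
        ((abs_sub_le _ (h (s m)) _).trans_eq (add_comm _ _)) hC)
    -- The intermediate point lies in an earlier piece or in the last one; the remaining part of the
    -- chain contributes only its increment.
    · rcases Nat.lt_succ_iff_lt_or_eq.1 hj with hj | rfl
      · refine le_trans ?_ (add_le_add (ihb j hj r hr) hstep)
        rw [← ENNReal.ofReal_add (by positivity) (by positivity), ← mul_add]
        refine ENNReal.ofReal_le_ofReal (mul_le_mul_of_nonneg_left ?_ hC)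
        linarith [abs_sub_le (h (s (m + 1))) (h (s m)) (h r)]
      · refine le_trans ?_ (add_le_add iha (hlast r hr))
        rw [← ENNReal.ofReal_add (by positivity) (by positivity), ← mul_add]
        refine ENNReal.ofReal_le_ofReal (mul_le_mul_of_nonneg_left ?_ hC)
        linarith [abs_sub_le (h r) (h (s j)) (h (s 0))]

end Variation

namespace GRWSpacetime

variable {n : ℕ} {S : Type*} [TopologicalSpace S]
  [ChartedSpace (EuclideanSpace ℝ (Fin n)) S] [IsManifold (𝓡 n) ∞ S]

/-! ### Lower bounds: the properties (F1), (F5), (F6) -/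

/-- `d` is bounded below by costs of piecewise smooth curves each of whose pieces costs at least
`C ∫ |t'|` and at least `C ∫ f |σ'|`. -/
def IsBoundedBelow (G : GRWSpacetime n S) (d : ℝ × S → ℝ × S → ℝ≥0∞) (C : ℝ) : Prop :=
  ∀ (p q : ℝ × S) (b : ℝ≥0∞), (∀ (γ : ℝ → ℝ × S) (m : ℕ) (s : ℕ → ℝ) (cost : ℕ → ℝ≥0∞),
    IsPiecewiseSmooth (model n) G.carrier γ m s → γ (s 0) = p → γ (s m) = q →
    (∀ i < m, ENNReal.ofReal C * ∫⁻ t in Icc (s i) (s (i + 1)), ENNReal.ofReal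
      |derivWithin (fun r => (γ r).1) (Icc (s i) (s (i + 1))) t| ≤ cost i) →
    (∀ i < m, ENNReal.ofReal C * ∫⁻ t in Icc (s i) (s (i + 1)), ENNReal.ofReal
      (G.f (γ t).1 * G.speed (fun r => (γ r).2) (s i) (s (i + 1)) t) ≤ cost i) →
    b ≤ ∑ i ∈ Finset.range m, cost i) → b ≤ d p q

section Lower

variable {C : ℝ} {γ : ℝ → ℝ × S} {m : ℕ} {s : ℕ → ℝ} {cost : ℕ → ℝ≥0∞}

theorem ofReal_time_variation_le_sum (G : GRWSpacetime n S) (hC : 0 ≤ C)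
    (hs : IsPiecewiseSmooth (model n) G.carrier γ m s)
    (hcost : ∀ i < m, ENNReal.ofReal C * ∫⁻ t in Icc (s i) (s (i + 1)), ENNReal.ofReal
      |derivWithin (fun r => (γ r).1) (Icc (s i) (s (i + 1))) t| ≤ cost i) :
    ENNReal.ofReal (C * |(γ (s m)).1 - (γ (s 0)).1|) ≤ ∑ i ∈ Finset.range m, cost i ∧
      ∀ j < m, ∀ r ∈ Icc (s j) (s (j + 1)),
        ENNReal.ofReal (C * (|(γ r).1 - (γ (s 0)).1| + |(γ (s m)).1 - (γ r).1|)) ≤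
          ∑ i ∈ Finset.range m, cost i := by
  refine ofReal_variation_le_sum (h := fun r => (γ r).1) hC (fun i hi => (hs.2 i hi).1.le)
    fun i hi r hr => ?_
  rw [ENNReal.ofReal_mul hC]
  exact (mul_le_mul_right (ofReal_abs_sub_add_abs_sub_le_lintegral
    ((contDiffOn_fst (hs.2 i hi).2.1).of_le (by simp)) hr) _).trans (hcost i hi)

/-- The spatial projection of the curve competes for `d_S`, and `f ≥ A` along it turns its length
into a lower bound for `∫ f |σ'|`. -/
theorem mul_spaceDist_le_sum (G : GRWSpacetime n S) {A : ℝ≥0∞}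
    (hs : IsPiecewiseSmooth (model n) G.carrier γ m s)
    (hA : ∀ i < m, ∀ t ∈ Icc (s i) (s (i + 1)), A ≤ ENNReal.ofReal (G.f (γ t).1))
    (hcost : ∀ i < m, ENNReal.ofReal C * ∫⁻ t in Icc (s i) (s (i + 1)), ENNReal.ofReal
      (G.f (γ t).1 * G.speed (fun r => (γ r).2) (s i) (s (i + 1)) t) ≤ cost i) :
    ENNReal.ofReal C * (A * G.spaceDist (γ (s 0)).2 (γ (s m)).2) ≤
      ∑ i ∈ Finset.range m, cost i := by
  have hσ : IsPiecewiseSmooth (𝓡 n) univ (fun r => (γ r).2) m s :=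
    ⟨hs.1, fun i hi => ⟨(hs.2 i hi).1, contMDiffOn_snd (hs.2 i hi).2.1, fun _ _ => mem_univ _⟩⟩
  have hd : G.spaceDist (γ (s 0)).2 (γ (s m)).2 ≤
      ∑ i ∈ Finset.range m, ∫⁻ t in Icc (s i) (s (i + 1)),
        ENNReal.ofReal (G.speed (fun r => (γ r).2) (s i) (s (i + 1)) t) :=
    iInf_le_of_le _ (iInf_le_of_le m (iInf_le_of_le s (iInf_le_of_le hσ
      (iInf_le_of_le rfl (iInf_le_of_le rfl le_rfl)))))
  refine (mul_le_mul_right (mul_le_mul_right hd A) _).trans ?_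
  rw [Finset.mul_sum, Finset.mul_sum]
  refine Finset.sum_le_sum fun i hi => ?_
  have hi := Finset.mem_range.1 hi
  refine (mul_le_mul_right ((lintegral_const_mul_le _ _).trans ?_) _).trans (hcost i hi)
  refine setLIntegral_mono' measurableSet_Icc fun t ht => ?_
  have hmem := (hs.2 i hi).2.2 ht
  rw [ENNReal.ofReal_mul (G.f_pos _ hmem.1 hmem.2).le]
  exact mul_le_mul_left (hA i hi t ht) _

end Lower

section BoundedBelow

variable {d : ℝ × S → ℝ × S → ℝ≥0∞} {C : ℝ}

theorem IsBoundedBelow.mono {G : GRWSpacetime n S} {d' : ℝ × S → ℝ × S → ℝ≥0∞}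
    (h : G.IsBoundedBelow d C) (hd : ∀ p q, d p q ≤ d' p q) : G.IsBoundedBelow d' C :=
  fun p q b hb => (h p q b hb).trans (hd p q)

theorem IsBoundedBelow.F1 {G : GRWSpacetime n S} (h : G.IsBoundedBelow d C) (hC : 0 < C) :
    G.F1 d C := by
  refine ⟨hC, fun p _ q _ _ => h p q _ ?_⟩
  rintro γ m s cost hs rfl rfl ht -
  exact (G.ofReal_time_variation_le_sum hC.le hs ht).1

theorem IsBoundedBelow.F5 {G : GRWSpacetime n S} (h : G.IsBoundedBelow d C) (hC : 0 < C) :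
    G.F5 d C := by
  refine ⟨hC, fun p _ q _ => h p q _ ?_⟩
  rintro γ m s cost hs rfl rfl - hσ
  rw [mul_assoc]
  exact G.mul_spaceDist_le_sum hs (fun i hi t ht => iInf₂_le (γ t).1 ((hs.2 i hi).2.2 ht)) hσ

/-- A time `r` of `I` outside the window lies at or beyond a window endpoint interior to `I`, hence
finite; going from `x` to `r` and on to `y` covers at least both distances to that endpoint. The
infinite exit cost never arises, since then the window is all of `I`. -/
theorem exitCost_le_of_exit (G : GRWSpacetime n S) {t₁ t₂ : EReal} {x y r : ℝ} (h₁₂ : t₁ < t₂)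
    (hr : r ∈ G.interval) (hexit : ¬(t₁ < r ∧ r < t₂)) :
    G.exitCost t₁ t₂ x y ≤ ENNReal.ofReal (|r - x| + |y - r|) := by
  rcases le_or_gt (r : EReal) t₁ with h | h
  · have ha : G.a < t₁ := hr.1.trans_le h
    have htop : t₁ ≠ ⊤ := (h₁₂.trans_le le_top).ne
    have hbot : t₁ ≠ ⊥ := (bot_le.trans_lt ha).ne'
    have hle : r ≤ t₁.toReal := by
      rw [← EReal.coe_toReal htop hbot] at h
      exact_mod_cast h
    have hb : x + y - 2 * t₁.toReal ≤ |r - x| + |y - r| := by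
      linarith [neg_abs_le (r - x), le_abs_self (y - r)]
    unfold exitCost
    rw [if_pos ha]
    split_ifs
    · exact ENNReal.ofReal_le_ofReal ((min_le_left _ _).trans hb)
    · exact ENNReal.ofReal_le_ofReal hb
  · have h := not_lt.1 fun h' => hexit ⟨h, h'⟩
    have hb : t₂ < G.b := h.trans_lt hr.2
    have htop : t₂ ≠ ⊤ := (hb.trans_le le_top).ne
    have hbot : t₂ ≠ ⊥ := (bot_le.trans_lt h₁₂).ne'
    have hle : t₂.toReal ≤ r := by
      rw [← EReal.coe_toReal htop hbot] at h
      exact_mod_cast h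
    have hb' : 2 * t₂.toReal - x - y ≤ |r - x| + |y - r| := by
      linarith [le_abs_self (r - x), neg_abs_le (y - r)]
    unfold exitCost
    rw [if_pos hb, if_pos hb]
    split_ifs
    · exact ENNReal.ofReal_le_ofReal ((min_le_right _ _).trans hb')
    · exact ENNReal.ofReal_le_ofReal hb'

theorem IsBoundedBelow.F6 {G : GRWSpacetime n S} (h : G.IsBoundedBelow d C) (hC : 0 < C) :
    G.F6 d C := by
  refine ⟨hC, fun t₁ t₂ _ h₁₂ _ p q _ _ _ _ => h p q _ ?_⟩
  rintro γ m s cost hs rfl rfl ht hσ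
  -- Either the curve never leaves the window and the spatial bound applies, or one exit time
  -- already forces the exit cost.
  by_cases hin : ∀ i < m, ∀ r ∈ Icc (s i) (s (i + 1)), t₁ < (γ r).1 ∧ (γ r).1 < t₂
  · exact (mul_le_mul_right (min_le_right _ _) _).trans
      (G.mul_spaceDist_le_sum hs (fun i hi r hr => iInf₂_le (γ r).1 (hin i hi r hr)) hσ)
  · push Not at hin
    obtain ⟨j, hj, r, hr, hexit⟩ := hin
    have hb := (G.ofReal_time_variation_le_sum hC.le hs ht).2 j hj r hr
    rw [ENNReal.ofReal_mul hC.le] at hb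
    exact (mul_le_mul_right ((min_le_left _ _).trans (G.exitCost_le_of_exit h₁₂
      ((hs.2 j hj).2.2 hr) fun h' => (hexit h'.1).not_gt h'.2)) _).trans hb

end BoundedBelow

/-! ### Bounds for the three distances and their assembly -/

section

variable {φ : ℝ → ℝ} {τ : ℝ × S → ℝ}

theorem isBoundedBelow_riemannianizedDist (G : GRWSpacetime n S)
    (hτ : ∀ p ∈ G.carrier, τ p = φ p.1) (hφ : ∀ r ∈ G.interval, 0 < deriv φ r) :
    G.IsBoundedBelow (G.riemannianizedDist τ) 1 := by
  intro p q b hb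
  refine le_iInf fun γ => le_iInf fun m => le_iInf fun s => le_iInf fun hs => le_iInf fun hp =>
    le_iInf fun hq => hb γ m s _ hs hp hq (fun i hi => ?_) (fun i hi => ?_)
  all_goals
    obtain ⟨hlt, hsm, hmaps⟩ := hs.2 i hi
    rw [ENNReal.ofReal_one, one_mul]
    refine setLIntegral_mono' measurableSet_Icc fun t ht => ENNReal.ofReal_le_ofReal ?_
    rw [G.riemannianize_velocity hτ hφ hsm hlt ht (hmaps ht)]
  · exact Real.abs_le_sqrt (le_add_of_nonneg_right (sq_nonneg _))
  · exact Real.le_sqrt_of_sq_le (le_add_of_nonneg_left (sq_nonneg _))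

/-- Elevator curves are a subclass measured by the same length; lower bounds pass to `elevatorDist`
and upper bounds to `riemannianizedDist`. -/
theorem riemannianizedDist_le_elevatorDist (G : GRWSpacetime n S) (τ : ℝ × S → ℝ) (p q : ℝ × S) :
    G.riemannianizedDist τ p q ≤ G.elevatorDist τ p q :=
  iInf_mono fun _ => iInf_mono fun _ => iInf_mono fun _ => le_iInf fun h => iInf_le_of_le h.1 le_rfl

/-- On a causal piece, `f |σ'| ≤ |t'|` and `∫ |t'|` is the difference of the end times. -/
theorem IsCausalPiece.bounds {G : GRWSpacetime n S} {γ : ℝ → ℝ × S} {u v : ℝ} (huv : u < v)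
    (hP : G.IsCausalPiece γ u v) :
    (∀ t ∈ Icc u v, G.f (γ t).1 * G.speed (fun r => (γ r).2) u v t ≤
      |derivWithin (fun r => (γ r).1) (Icc u v) t|) ∧
    ∫⁻ t in Icc u v, ENNReal.ofReal |derivWithin (fun r => (γ r).1) (Icc u v) t| =
      ENNReal.ofReal |(γ v).1 - (γ u).1| := by
  obtain ⟨⟨hsm, hmaps⟩, h⟩ := hP
  have hC1 : ContDiffOn ℝ 1 (fun r => (γ r).1) (Icc u v) := (contDiffOn_fst hsm).of_le (by simp)
  have hle : ∀ t ∈ Icc u v, G.metric (γ t) (velocity (model n) γ u v t)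
      (velocity (model n) γ u v t) ≤ 0 → G.f (γ t).1 * G.speed (fun r => (γ r).2) u v t ≤
        |derivWithin (fun r => (γ r).1) (Icc u v) t| := by
    intro t ht hneg
    rw [G.metric_velocity hsm huv ht, sub_nonpos] at hneg
    exact (le_abs_self _).trans (sq_le_sq.1 hneg)
  rcases h with h | h | h
  · refine ⟨fun t ht => hle t ht (h t ht).1, lintegral_derivWithin_of_nonneg hC1 huv fun t ht => ?_⟩
    have := (h t ht).2
    rw [G.metric_timeField_velocity hsm huv ht] at this
    linarith
  · refine ⟨fun t ht => hle t ht (h t ht).1, lintegral_derivWithin_of_nonpos hC1 huv fun t ht => ?_⟩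
    have := (h t ht).2
    rw [G.metric_timeField_velocity hsm huv ht] at this
    linarith
  -- A constant piece is causal in neither sense, but its velocity vanishes, which makes both claims
  -- trivial.
  · have hvel : ∀ t ∈ Icc u v, velocity (model n) γ u v t = 0 := by
      intro t ht
      have h1 := ((hasMFDerivWithinAt_const (I := 𝓘(ℝ, ℝ)) (I' := model n) (s := Icc u v)
        (c := γ u) (x := t))).congr_of_eventuallyEq
        (Filter.eventuallyEq_of_mem self_mem_nhdsWithin h) (h t ht)
      unfold velocity
      rw [h1.mfderivWithin (uniqueDiffOn_Icc huv t ht).uniqueMDiffWithinAt]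
      rfl
    refine ⟨fun t ht => hle t ht ?_, lintegral_derivWithin_of_nonneg hC1 huv fun t ht => ?_⟩
    · rw [hvel t ht, metric_apply, map_zero, map_zero, map_zero]
      simp
    · rw [← differential_fst_velocity hsm huv ht, hvel t ht, map_zero]

theorem mul_abs_sub_le_of_le_deriv (G : GRWSpacetime n S) {C : ℝ}
    (hφ : ∀ r ∈ G.interval, 0 < deriv φ r) (hC : ∀ r ∈ G.interval, C ≤ deriv φ r) {t₀ t₁ : ℝ}
    (h₀ : t₀ ∈ G.interval) (h₁ : t₁ ∈ G.interval) : C * |t₁ - t₀| ≤ |φ t₁ - φ t₀| := by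
  have hdiff : ∀ r ∈ G.interval, DifferentiableAt ℝ φ r := fun r hr =>
    differentiableAt_of_deriv_ne_zero (hφ r hr).ne'
  wlog hle : t₀ ≤ t₁ generalizing t₀ t₁
  · rw [abs_sub_comm, abs_sub_comm (φ t₁)]
    exact this h₁ h₀ (le_of_not_ge hle)
  rw [abs_of_nonneg (sub_nonneg.2 hle)]
  refine le_trans ?_ (le_abs_self _)
  exact G.ordConnected_interval.convex.mul_sub_le_image_sub_of_le_deriv
    (fun r hr => (hdiff r hr).continuousAt.continuousWithinAt)
    (fun r hr => (hdiff r (interior_subset hr)).differentiableWithinAt)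
    (fun r hr => hC r (interior_subset hr)) t₀ h₀ t₁ h₁ hle

/-- On a causal piece `C ∫ f |σ'| ≤ C ∫ |t'| = C |Δt| ≤ |Δφ|`, which is the cost of the piece. -/
theorem isBoundedBelow_nullDistance (G : GRWSpacetime n S) {C : ℝ} (hC0 : 0 ≤ C)
    (hτ : ∀ p ∈ G.carrier, τ p = φ p.1) (hφ : ∀ r ∈ G.interval, 0 < deriv φ r)
    (hC : ∀ r ∈ G.interval, C ≤ deriv φ r) : G.IsBoundedBelow (G.nullDistance τ) C := by
  intro p q b hb
  rw [nullDistance_eq_chainDist]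
  refine le_iInf fun γ => le_iInf fun m => le_iInf fun s => le_iInf fun hs => le_iInf fun hp =>
    le_iInf fun hq => hb γ m s _ ⟨hs.1, fun i hi => ⟨(hs.2 i hi).1, (hs.2 i hi).2.1⟩⟩ hp hq ?_ ?_
  all_goals
    intro i hi
    obtain ⟨hlt, hP⟩ := hs.2 i hi
    obtain ⟨hle, hvar⟩ := hP.bounds hlt
    have hu := hP.1.2 (left_mem_Icc.2 hlt.le)
    have hv := hP.1.2 (right_mem_Icc.2 hlt.le)
    have hcost : ENNReal.ofReal C * ENNReal.ofReal |(γ (s (i + 1))).1 - (γ (s i)).1| ≤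
        ENNReal.ofReal |τ (γ (s (i + 1))) - τ (γ (s i))| := by
      rw [← ENNReal.ofReal_mul hC0, hτ _ hu, hτ _ hv]
      exact ENNReal.ofReal_le_ofReal (G.mul_abs_sub_le_of_le_deriv hφ hC hu hv)
  · rwa [hvar]
  · refine (mul_le_mul_right ?_ _).trans hcost
    rw [← hvar]
    exact setLIntegral_mono' measurableSet_Icc fun t ht => ENNReal.ofReal_le_ofReal (hle t ht)

/-- Riemannianized lengths do not depend on the function of time used. -/
theorem arcLength_riemannianize_eq (G : GRWSpacetime n S)
    (hτ : ∀ p ∈ G.carrier, τ p = φ p.1) (hφ : ∀ r ∈ G.interval, 0 < deriv φ r)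
    {γ : ℝ → ℝ × S} {m : ℕ} {s : ℕ → ℝ} (hs : IsPiecewiseSmooth (model n) G.carrier γ m s) :
    arcLength (model n) (riemannianize (model n) G.metric τ) γ m s =
      arcLength (model n) (riemannianize (model n) G.metric Prod.fst) γ m s := by
  refine Finset.sum_congr rfl fun i hi => ?_
  obtain ⟨hlt, hsm, hmaps⟩ := hs.2 i (Finset.mem_range.1 hi)
  refine setLIntegral_congr_fun measurableSet_Icc fun t ht => ?_
  rw [G.riemannianize_velocity hτ hφ hsm hlt ht (hmaps ht),
    G.riemannianize_velocity (φ := id) (τ := Prod.fst) (fun _ _ => rfl) (by simp) hsm hlt ht (hmaps ht)]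

theorem riemannianizedDist_eq (G : GRWSpacetime n S)
    (hτ : ∀ p ∈ G.carrier, τ p = φ p.1) (hφ : ∀ r ∈ G.interval, 0 < deriv φ r) (p q : ℝ × S) :
    G.riemannianizedDist τ p q = G.riemannianizedDist Prod.fst p q :=
  iInf_congr fun _ => iInf_congr fun _ => iInf_congr fun _ => iInf_congr fun hs =>
    iInf_congr fun _ => iInf_congr fun _ => G.arcLength_riemannianize_eq hτ hφ hs

theorem elevatorDist_eq (G : GRWSpacetime n S)
    (hτ : ∀ p ∈ G.carrier, τ p = φ p.1) (hφ : ∀ r ∈ G.interval, 0 < deriv φ r) (p q : ℝ × S) :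
    G.elevatorDist τ p q = G.elevatorDist Prod.fst p q :=
  iInf_congr fun _ => iInf_congr fun _ => iInf_congr fun _ => iInf_congr fun hs =>
    iInf_congr fun _ => iInf_congr fun _ => G.arcLength_riemannianize_eq hτ hφ hs.1

theorem faithful_elevatorDist (G : GRWSpacetime n S)
    (hτ : ∀ p ∈ G.carrier, τ p = φ p.1) (hφ : ∀ r ∈ G.interval, 0 < deriv φ r) :
    G.Faithful (G.elevatorDist τ) 1 1 1 1 1 1 := by
  have hlow := (G.isBoundedBelow_riemannianizedDist hτ hφ).mono
    (G.riemannianizedDist_le_elevatorDist τ)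
  have h2 : G.F2 (G.elevatorDist τ) 1 := by
    refine ⟨one_pos, ?_⟩
    rintro ⟨t₀, x⟩ hp ⟨t₁, y⟩ hq (rfl : x = y)
    rw [one_mul]
    exact G.elevatorDist_vertical_le hτ hφ hp hq x
  have h3 : G.F3 (G.elevatorDist τ) 1 :=
    G.F3_of_horizontal_le one_pos (G.elevatorDist_triangle τ) fun t₀ h₀ σ u v huv hσ => by
      rw [ENNReal.ofReal_one, one_mul]
      exact G.elevatorDist_horizontal_le hτ hφ h₀ huv hσ
  exact ⟨hlow.F1 one_pos, h2, h3, G.F4_of_F2_of_F3 (G.elevatorDist_triangle τ) h2 h3,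
    hlow.F5 one_pos, hlow.F6 one_pos⟩

theorem faithful_riemannianizedDist (G : GRWSpacetime n S)
    (hτ : ∀ p ∈ G.carrier, τ p = φ p.1) (hφ : ∀ r ∈ G.interval, 0 < deriv φ r) :
    G.Faithful (G.riemannianizedDist τ) 1 1 1 1 1 1 := by
  have hlow := G.isBoundedBelow_riemannianizedDist hτ hφ
  have hle := G.riemannianizedDist_le_elevatorDist τ
  obtain ⟨-, h2, h3, h4, -, -⟩ := G.faithful_elevatorDist hτ hφ
  exact ⟨hlow.F1 one_pos, ⟨one_pos, fun p hp q hq h => (hle p q).trans (h2.2 p hp q hq h)⟩,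
    ⟨one_pos, fun p hp q hq h => (hle p q).trans (h3.2 p hp q hq h)⟩,
    ⟨one_pos, fun p hp q hq c hc => (hle p q).trans (h4.2 p hp q hq c hc)⟩,
    hlow.F5 one_pos, hlow.F6 one_pos⟩

theorem faithful_nullDistance (G : GRWSpacetime n S) {C D : ℝ} (hC : 0 < C) (hD : 0 < D)
    (hτ : ∀ p ∈ G.carrier, τ p = φ p.1) (hφC : ∀ r ∈ G.interval, C ≤ deriv φ r)
    (hφD : ∀ r ∈ G.interval, deriv φ r ≤ D) : G.Faithful (G.nullDistance τ) C D D D C C := by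
  have hφ : ∀ r ∈ G.interval, 0 < deriv φ r := fun r hr => hC.trans_le (hφC r hr)
  have hlow := G.isBoundedBelow_nullDistance hC.le hτ hφ hφC
  have h2 : G.F2 (G.nullDistance τ) D := by
    refine ⟨hD, ?_⟩
    rintro ⟨t₀, x⟩ hp ⟨t₁, y⟩ hq (rfl : x = y)
    exact (G.nullDistance_vertical_le hτ hp hq x).trans
      (ENNReal.ofReal_le_ofReal (G.abs_sub_le_of_deriv_le hφ hφD hp hq))
  have h3 : G.F3 (G.nullDistance τ) D :=
    G.F3_of_horizontal_le hD (G.nullDistance_triangle τ) fun t₀ h₀ σ u v huv hσ =>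
      G.nullDistance_horizontal_le hτ hφ hφD h₀ huv hσ
  exact ⟨hlow.F1 hC, h2, h3, G.F4_of_F2_of_F3 (G.nullDistance_triangle τ) h2 h3,
    hlow.F5 hC, hlow.F6 hC⟩

/-- The null distance is at least the difference of the values of the time function. -/
theorem ofReal_abs_sub_le_nullDistance (G : GRWSpacetime n S) (τ : ℝ × S → ℝ) (p q : ℝ × S) :
    ENNReal.ofReal |τ q - τ p| ≤ G.nullDistance τ p q := by
  refine le_iInf fun γ => le_iInf fun m => le_iInf fun s => le_iInf fun _ => le_iInf fun hp =>
    le_iInf fun hq => ENNReal.ofReal_le_ofReal ?_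
  rw [← hp, ← hq, ← Finset.sum_range_sub (fun i => τ (γ (s i)))]
  exact Finset.abs_sum_le_sum_abs _ _

/-- The vertical segment is causal or constant and attains the general lower bound `|τ q - τ p|`. -/
theorem nullDistance_vertical_eq (G : GRWSpacetime n S)
    (hτ : ∀ p ∈ G.carrier, τ p = φ p.1) {t₀ t₁ : ℝ}
    (h₀ : t₀ ∈ G.interval) (h₁ : t₁ ∈ G.interval) (z : S) :
    G.nullDistance τ (t₀, z) (t₁, z) = ENNReal.ofReal |φ t₁ - φ t₀| := by
  refine le_antisymm (G.nullDistance_vertical_le hτ h₀ h₁ z) ?_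
  have := G.ofReal_abs_sub_le_nullDistance τ (t₀, z) (t₁, z)
  rwa [hτ (t₀, z) h₀, hτ (t₁, z) h₁] at this

/-- On one vertical line (F1) and (F2) say that the absolute slopes of `φ` lie in `[C₁, C₂]`; their
limit at `t` is `φ' t`. A point of `S` is needed to have such a line. -/
theorem deriv_bounds_of_F1_of_F2 [Nonempty S] (G : GRWSpacetime n S)
    (hτ : ∀ p ∈ G.carrier, τ p = φ p.1) (hφ : ∀ r ∈ G.interval, 0 < deriv φ r) {C₁ C₂ : ℝ}
    (h1 : G.F1 (G.nullDistance τ) C₁) (h2 : G.F2 (G.nullDistance τ) C₂) {t : ℝ}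
    (ht : t ∈ G.interval) : C₁ ≤ deriv φ t ∧ deriv φ t ≤ C₂ := by
  obtain ⟨z⟩ := ‹Nonempty S›
  have hlim := (hasDerivAt_iff_tendsto_slope.1
    (differentiableAt_of_deriv_ne_zero (hφ t ht).ne').hasDerivAt).abs
  rw [abs_of_pos (hφ t ht)] at hlim
  have hev : ∀ᶠ r in nhdsWithin t {t}ᶜ, C₁ ≤ |slope φ t r| ∧ |slope φ t r| ≤ C₂ := by
    filter_upwards [self_mem_nhdsWithin,
      mem_nhdsWithin_of_mem_nhds (G.isOpen_interval.mem_nhds ht)] with r hr hrI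
    have hpos : 0 < |r - t| := abs_pos.2 (sub_ne_zero.2 hr)
    have e1 := h1.2 (t, z) ht (r, z) hrI rfl
    have e2 := h2.2 (t, z) ht (r, z) hrI rfl
    rw [G.nullDistance_vertical_eq hτ ht hrI, ENNReal.ofReal_le_ofReal_iff (abs_nonneg _)] at e1
    rw [G.nullDistance_vertical_eq hτ ht hrI,
      ENNReal.ofReal_le_ofReal_iff (mul_nonneg h2.1.le (abs_nonneg _))] at e2
    rw [slope_def_field, abs_div]
    exact ⟨(le_div_iff₀ hpos).2 e1, (div_le_iff₀ hpos).2 e2⟩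
  exact ⟨ge_of_tendsto hlim (hev.mono fun _ h => h.1), le_of_tendsto hlim (hev.mono fun _ h => h.2)⟩

end

end GRWSpacetime

end

theorem mainTheorem2 {n : ℕ} {S : Type*} [TopologicalSpace S] [T2Space S] [ConnectedSpace S]
    [ChartedSpace (EuclideanSpace ℝ (Fin n)) S] [IsManifold (𝓡 n) ∞ S]
    (G : GRWSpacetime n S) (φ : ℝ → ℝ) (hφ : ContDiffOn ℝ ∞ φ G.interval)
    (hφ' : ∀ t ∈ G.interval, 0 < deriv φ t)
    (τ : ℝ × S → ℝ) (hτ : ∀ p ∈ G.carrier, τ p = φ p.1) :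
    -- (a) the Riemannianized distance
    ((∀ p ∈ G.carrier, ∀ q ∈ G.carrier,
        G.riemannianizedDist τ p q = G.riemannianizedDist Prod.fst p q) ∧
      G.Faithful (G.riemannianizedDist τ) 1 1 1 1 1 1) ∧
    -- (b) the elevator distance
    ((∀ p ∈ G.carrier, ∀ q ∈ G.carrier,
        G.elevatorDist τ p q = G.elevatorDist Prod.fst p q) ∧
      G.Faithful (G.elevatorDist τ) 1 1 1 1 1 1) ∧
    -- (c) the null distance
    (∀ C D : ℝ, 0 < C → 0 < D → (∀ t ∈ G.interval, C ≤ deriv φ t ∧ deriv φ t ≤ D) →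
      G.Faithful (G.nullDistance τ) C D D D C C) ∧
    (∀ C₁ C₂ : ℝ, G.F1 (G.nullDistance τ) C₁ → G.F2 (G.nullDistance τ) C₂ →
      ∀ t ∈ G.interval, C₁ ≤ deriv φ t ∧ deriv φ t ≤ C₂) ∧
    ((∃ C₁ C₂ C₃ C₄ C₅ C₆ : ℝ, G.Faithful (G.nullDistance τ) C₁ C₂ C₃ C₄ C₅ C₆) ↔
      (∃ C₁ : ℝ, G.F1 (G.nullDistance τ) C₁) ∧ (∃ C₂ : ℝ, G.F2 (G.nullDistance τ) C₂)) ∧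
    G.Faithful (G.nullDistance Prod.fst) 1 1 1 1 1 1 := by
  refine ⟨⟨fun p _ q _ => G.riemannianizedDist_eq hτ hφ' p q, G.faithful_riemannianizedDist hτ hφ'⟩,
    ⟨fun p _ q _ => G.elevatorDist_eq hτ hφ' p q, G.faithful_elevatorDist hτ hφ'⟩,
    fun C D hC hD h => G.faithful_nullDistance hC hD hτ (fun t ht => (h t ht).1)
      (fun t ht => (h t ht).2),
    fun C₁ C₂ h1 h2 t ht => G.deriv_bounds_of_F1_of_F2 hτ hφ' h1 h2 ht, ⟨?_, ?_⟩,
    G.faithful_nullDistance (φ := id) one_pos one_pos (fun _ _ => rfl) (by simp) (by simp)⟩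
  · rintro ⟨C₁, C₂, C₃, C₄, C₅, C₆, h1, h2, -⟩
    exact ⟨⟨C₁, h1⟩, ⟨C₂, h2⟩⟩
  -- The constants of (F1) and (F2) bound `φ'` by the converse, and these bounds feed back into the
  -- direct part.
  · rintro ⟨⟨C₁, h1⟩, ⟨C₂, h2⟩⟩
    exact ⟨C₁, C₂, C₂, C₂, C₁, C₁, G.faithful_nullDistance h1.1 h2.1 hτ
      (fun t ht => (G.deriv_bounds_of_F1_of_F2 hτ hφ' h1 h2 ht).1)
      (fun t ht => (G.deriv_bounds_of_F1_of_F2 hτ hφ' h1 h2 ht).2)⟩
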